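/- **The groups $\Gamma_n^k$.** A standard Gale diagram of order $l$ is an $l$-element set $\bar Y=\{\bar y_1,\dots,\bar y_l\}$ of vertices of the regular $2l$-gon $\{e^{\pi i p/l}\}_{p=0}^{2l-1}$, listed counterclockwise, such that every diameter of the unit circle contains at most one point of $\bar Y$ and every open half-plane bounded by a diameter contains at least two points of $\bar Y$. Let $R_{\bar Y}(i)$ (resp. $L_{\bar Y}(i)$) be the set of indices $j$ such that $\bar y_j$ lies in the open right (resp. left) half-plane of the oriented line spanned by $\bar y_i$. For $4\le k\le n$ the group $\Gamma_n^k$ has generators $a_{P,Q}$, where $P,Q\subset\{1,\dots,n\}$, $P\cap Q=\emptyset$, $|P\cup Q|=k$, $|P|,|Q|\ge 2$, and the relations 1. $a_{Q,P}=a_{P,Q}^{-1}$; 2. $a_{P,Q}a_{P',Q'}=a_{P',Q'}a_{P,Q}$ whenever $|P\cap(P'\cup Q')|<|P|$, $|Q\cap(P'\cup Q')|<|Q|$, $|P'\cap(P\cup Q)|<|P'|$ and $|Q'\cap(P\cup Q)|<|Q'|$; 3. $\prod_{i=1}^{k+1}a_{\{m_j\}_{j\in R_{\bar Y}(i)},\,\{m_j\}_{j\in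 L_{\bar Y}(i)}}=1$ for every standard Gale diagram $\bar Y$ of order $k+1$ and all distinct $m_1,\dots,m_{k+1}\in\{1,\dots,n\}$. $Cay(\Gamma_n^k)$ is the (simple, undirected) Cayley graph of $\Gamma_n^k$ with respect to the generators $a_{P,Q}$. **Associahedron and flip graph.** Number the vertices of a convex $n$-gon in cyclic order. A dissection is a set of pairwise noncrossing diagonals, and a triangulation is a maximal dissection. The flip graph has the triangulations as vertices, two of them being adjacent if one is obtained from the other by replacing one diagonal by another one. The associahedron (Stasheff polytope) $K_{n-1}$ is the polytope whose poset of nonempty faces is isomorphic to the set of dissections of the convex $n$-gon ordered by reverse inclusion. Its edge graph has as vertices the vertices of the polytope, two of them being adjacent if they are joined by an edge (a one-dimensional face) of the polytope. **Corollary.** Let $n\ge 4$. The edge graph of the associahedron $K_{n-1}$ is isomorphic to the flip graph of triangulations of a convex $n$-gon, and the graph $Cay(\Gamma_n^4)$ contains a subgraph isomorphic to it. This holds for the edge graph read off from the face poset of $K_{n-1}$, and also for the edge graph (extreme points, and segments joining two of them that are faces) of every convex polytope in a Euclidean space that realizes $K_{n-1}$. -/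

import Mathlib

/-! ### The groups `Γ_n^k` -/

/-- The vertex `exp (π i p / l)` of the regular `2l`-gon inscribed in the unit circle. -/
noncomputable def galeVertex (l p : ℕ) : ℂ :=
  Complex.exp (Real.pi * Complex.I * p / l)

/-- The oriented area `det (u, v)`. It is positive iff `v` lies in the open left half-plane, and
negative iff `v` lies in the open right half-plane, of the oriented line spanned by `u`. -/
noncomputable def planeDet (u v : ℂ) : ℝ :=
  u.re * v.im - u.im * v.re

/-- A standard Gale diagram of order `l`: an `l`-element set of vertices of the regular `2l`-gon
inscribed in the unit circle, listed counterclockwise, such that every diameter contains at most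
one of its points and every open half-plane bounded by a diameter contains at least two. -/
structure StandardGaleDiagram (l : ℕ) where
  /-- The `j`-th point of the diagram is the vertex number `pos j` of the `2l`-gon. -/
  pos : Fin l → ℕ
  pos_strictMono : StrictMono pos
  pos_lt : ∀ j, pos j < 2 * l
  diameter : ∀ i j, i ≠ j → planeDet (galeVertex l (pos i)) (galeVertex l (pos j)) ≠ 0
  halfPlane : ∀ u : ℂ, u ≠ 0 →
    2 ≤ (Finset.univ.filter fun j => 0 < planeDet u (galeVertex l (pos j))).card

namespace StandardGaleDiagram

variable {l : ℕ} (Y : StandardGaleDiagram l)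

/-- The points of the diagram. -/
noncomputable def point (j : Fin l) : ℂ := galeVertex l (Y.pos j)

/-- `R(i)`: indices of the points in the open right half-plane of the oriented line spanned by the
`i`-th point. -/
noncomputable def right (i : Fin l) : Finset (Fin l) :=
  Finset.univ.filter fun j => planeDet (Y.point i) (Y.point j) < 0

/-- `L(i)`: indices of the points in the open left half-plane of the oriented line spanned by the
`i`-th point. -/
noncomputable def left (i : Fin l) : Finset (Fin l) :=
  Finset.univ.filter fun j => 0 < planeDet (Y.point i) (Y.point j)

theorem point_ne_zero (i : Fin l) : Y.point i ≠ 0 := Complex.exp_ne_zero _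

theorem disjoint_right_left (i : Fin l) : Disjoint (Y.right i) (Y.left i) := by
  rw [Finset.disjoint_left]
  intro j hr hl
  simp only [right, left, Finset.mem_filter, Finset.mem_univ, true_and] at hr hl
  exact lt_asymm hr hl

theorem two_le_card_left (i : Fin l) : 2 ≤ (Y.left i).card :=
  Y.halfPlane (Y.point i) (Y.point_ne_zero i)

theorem two_le_card_right (i : Fin l) : 2 ≤ (Y.right i).card := by
  refine (Y.halfPlane (-Y.point i) (neg_ne_zero.mpr (Y.point_ne_zero i))).trans
    (Finset.card_le_card fun j hj => ?_)
  have h := (Finset.mem_filter.mp hj).2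
  refine Finset.mem_filter.mpr ⟨Finset.mem_univ j, ?_⟩
  simp only [planeDet, point, Complex.neg_re, Complex.neg_im] at h ⊢
  linarith

theorem right_union_left (i : Fin l) : Y.right i ∪ Y.left i = {i}ᶜ := by
  ext j
  simp only [right, left, Finset.mem_union, Finset.mem_filter, Finset.mem_univ, true_and,
    Finset.mem_compl, Finset.mem_singleton]
  constructor
  · rintro h rfl
    have h0 : planeDet (Y.point j) (Y.point j) = 0 := by unfold planeDet; ring
    rw [h0] at h
    simp at h
  · intro hij
    exact lt_or_gt_of_ne (Y.diameter i j (Ne.symm hij))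

end StandardGaleDiagram

/-- The pairs `(P, Q)` of disjoint subsets of an `n`-element set with `|P ∪ Q| = k` and
`|P|, |Q| ≥ 2`: the indices of the generators `a_{P,Q}` of `Γ_n^k`. -/
@[ext]
structure PachnerType (n k : ℕ) where
  P : Finset (Fin n)
  Q : Finset (Fin n)
  disjoint : Disjoint P Q
  card_union : (P ∪ Q).card = k
  two_le_card_P : 2 ≤ P.card
  two_le_card_Q : 2 ≤ Q.card

namespace PachnerType

variable {n k : ℕ}

/-- The pair `(Q, P)`. -/
def swap (a : PachnerType n k) : PachnerType n k where
  P := a.Q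
  Q := a.P
  disjoint := a.disjoint.symm
  card_union := by rw [Finset.union_comm]; exact a.card_union
  two_le_card_P := a.two_le_card_Q
  two_le_card_Q := a.two_le_card_P

/-- The hypothesis of the far commutativity relation for `a_{P,Q}` and `a_{P',Q'}`. -/
def IsFar (a b : PachnerType n k) : Prop :=
  (a.P ∩ (b.P ∪ b.Q)).card < a.P.card ∧ (a.Q ∩ (b.P ∪ b.Q)).card < a.Q.card ∧
    (b.P ∩ (a.P ∪ a.Q)).card < b.P.card ∧ (b.Q ∩ (a.P ∪ a.Q)).card < b.Q.card

/-- The pair `(M_R(Y,i), M_L(Y,i))`, where `M_R(Y,i) = {m_j : j ∈ R(i)}` and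
`M_L(Y,i) = {m_j : j ∈ L(i)}`. -/
noncomputable def ofGale (Y : StandardGaleDiagram (k + 1)) (m : Fin (k + 1) ↪ Fin n)
    (i : Fin (k + 1)) : PachnerType n k where
  P := (Y.right i).map m
  Q := (Y.left i).map m
  disjoint := (Finset.disjoint_map m).mpr (Y.disjoint_right_left i)
  card_union := by
    rw [← Finset.map_union, Finset.card_map, Y.right_union_left i, Finset.card_compl]
    simp
  two_le_card_P := by rw [Finset.card_map]; exact Y.two_le_card_right i
  two_le_card_Q := by rw [Finset.card_map]; exact Y.two_le_card_left i

end PachnerType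

/-- The defining relators of `Γ_n^k`. -/
inductive IsGammaRelator (n k : ℕ) : FreeGroup (PachnerType n k) → Prop
  /-- `a_{Q,P} = a_{P,Q}⁻¹` -/
  | inverse (a : PachnerType n k) :
      IsGammaRelator n k (FreeGroup.of a.swap * FreeGroup.of a)
  /-- far commutativity -/
  | farCommutativity (a b : PachnerType n k) (h : a.IsFar b) :
      IsGammaRelator n k
        (FreeGroup.of a * FreeGroup.of b * (FreeGroup.of b * FreeGroup.of a)⁻¹)
  /-- the `(k+1)`-gon relations; `m` enumerates the subset `{m_1, …, m_{k+1}}` in any order -/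
  | gon (Y : StandardGaleDiagram (k + 1)) (m : Fin (k + 1) ↪ Fin n) :
      IsGammaRelator n k (List.ofFn fun i => FreeGroup.of (PachnerType.ofGale Y m i)).prod

/-- The group `Γ_n^k`, given by its generators and relations. -/
abbrev GammaGroup (n k : ℕ) : Type := PresentedGroup {r | IsGammaRelator n k r}

/-- The Cayley graph of `Γ_n^k` with respect to the generators `a_{P,Q}`. -/
def gammaCayleyGraph (n k : ℕ) : SimpleGraph (GammaGroup n k) :=
  SimpleGraph.mulCayley
    (Set.range (PresentedGroup.of : PachnerType n k → GammaGroup n k))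

/-! ### Triangulations of a convex polygon -/

/-- The diagonals of a convex `n`-gon whose vertices are numbered `0, …, n - 1` in cyclic order:
pairs of vertices `fst < snd` which are not the ends of a side. -/
@[ext]
structure Diagonal (n : ℕ) where
  fst : Fin n
  snd : Fin n
  fst_succ_lt_snd : fst.val + 1 < snd.val
  not_last_side : ¬(fst.val = 0 ∧ snd.val + 1 = n)
deriving DecidableEq

/-- Two diagonals of a convex polygon cross (meet in an interior point of both) iff their ends
interleave in the cyclic order. -/
def Diagonal.Crosses {n : ℕ} (d e : Diagonal n) : Prop :=
  (d.fst < e.fst ∧ e.fst < d.snd ∧ d.snd < e.snd) ∨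
    (e.fst < d.fst ∧ d.fst < e.snd ∧ e.snd < d.snd)

/-- A dissection of a convex `n`-gon: a set of pairwise noncrossing diagonals. Dissections are
ordered by inclusion. -/
abbrev Dissection (n : ℕ) : Type :=
  {D : Finset (Diagonal n) // ∀ d ∈ D, ∀ e ∈ D, ¬d.Crosses e}

/-- A triangulation of a convex `n`-gon: a maximal set of pairwise noncrossing diagonals. -/
abbrev PolygonTriangulation (n : ℕ) : Type := {T : Dissection n // IsMax T}

/-- The flip graph: two triangulations of a convex `n`-gon are adjacent iff one is obtained from
the other by replacing one diagonal by another one. -/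
def flipGraph (n : ℕ) : SimpleGraph (PolygonTriangulation n) where
  Adj S T := (S.1.1 \ T.1.1).card = 1 ∧ (T.1.1 \ S.1.1).card = 1
  symm := ⟨fun _ _ h => ⟨h.2, h.1⟩⟩
  loopless := ⟨fun _ h => by simp at h⟩

/-! ### The associahedron -/

/-- The poset of nonempty faces of the associahedron (Stasheff polytope) `K_{n-1}`: the dissections
of a convex `n`-gon (equivalently, the bracketings of `n - 1` letters), ordered by reverse
inclusion. The polytope itself is the empty dissection, the vertices are the triangulations. -/
abbrev AssociahedronFace (n : ℕ) : Type := (Dissection n)ᵒᵈ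

/-- The edge graph of a polytope with poset of nonempty faces `F`: the vertices are the minimal
faces, and two distinct vertices `u`, `v` are adjacent iff there is an edge joining them, that is,
a face `e` whose only nonempty faces are `u`, `v` and `e` itself. -/
def faceEdgeGraph (F : Type*) [PartialOrder F] : SimpleGraph {v : F // IsMin v} where
  Adj u v := u ≠ v ∧ ∃ e : F, Set.Iic e = {u.1, v.1, e}
  symm := ⟨by
    rintro u v ⟨h, e, he⟩
    exact ⟨h.symm, e, by rw [he]; exact Set.insert_comm _ _ _⟩⟩
  loopless := ⟨fun _ h => h.1 rfl⟩

/-- A convex polytope: the convex hull of a finite set of points. -/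
def IsConvexPolytope {d : ℕ} (K : Set (EuclideanSpace ℝ (Fin d))) : Prop :=
  ∃ S : Set (EuclideanSpace ℝ (Fin d)), S.Finite ∧ K = convexHull ℝ S

/-- The nonempty faces of a convex polytope (the nonempty convex subsets that contain
both ends of every segment of `K` whose relative interior they meet), ordered by inclusion. -/
abbrev PolytopeFace {d : ℕ} (K : Set (EuclideanSpace ℝ (Fin d))) : Type :=
  {A : Set (EuclideanSpace ℝ (Fin d)) // A.Nonempty ∧ Convex ℝ A ∧ IsExtreme ℝ K A}

/-- `K` is a realization of the associahedron `K_{n-1}` as a convex polytope. -/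
def IsAssociahedron (n : ℕ) {d : ℕ} (K : Set (EuclideanSpace ℝ (Fin d))) : Prop :=
  IsConvexPolytope K ∧ Nonempty (PolytopeFace K ≃o AssociahedronFace n)

/-- The edge graph of a convex polytope in a Euclidean space: its vertices are the extreme points,
and two of them are adjacent iff the segment joining them is a face. -/
def polytopeEdgeGraph {d : ℕ} (K : Set (EuclideanSpace ℝ (Fin d))) :
    SimpleGraph (K.extremePoints ℝ) where
  Adj u v := u ≠ v ∧ IsExtreme ℝ K (segment ℝ u.1 v.1)
  symm := ⟨fun u v h => ⟨h.1.symm, by rw [segment_symm]; exact h.2⟩⟩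
  loopless := ⟨fun _ h => h.1 rfl⟩

/-!
The flip graph of a convex `n`-gon embeds into the Cayley graph of `Γ_n^4` because the flips of
triangulations satisfy the relations of the group: `a_{P,Q}` with `P = {r, s}` and `Q = {p, q}`
stands for the flip which replaces the diagonal `pq` of a quadrilateral by `rs`, and the pentagon
relation says that the five flips around a pentagon compose to the identity.

*The embedding.* A triangulation is sent to the inverse of an explicit element of `Γ_n^4`, its
`potential`, a product over its triangles `a < b < c` with `a > 0` of the generators for the flips
`ac → 0b`, parents before children in the binary tree of triangles rooted at the side `0, n - 1`.
It records a way of flipping the triangulation to the fan at `0`. A flip `ik → jl` with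
`i < j < k < l` changes the two factors of the triangles involved as prescribed by the pentagon
relation for `0, i, j, k, l` (`flipGen_fan`), and the generator of the flip commutes with all
factors in front of these (`flipGen_commute`). Hence the potentials of the two triangulations differ
by this generator (`IsFlip.potential_eq`). An explicit potential makes it unnecessary to decompose
closed paths of flips into squares and pentagons.

*Injectivity.* A Gale diagram of order five is a regular pentagon up to the position of its points
(`StandardGaleDiagram.left_right_eq`), so a pentagon relation creates and deletes each of its five
diagonals exactly once. Counting how often a given diagonal is created is therefore a homomorphism
to `ℤ` (`countHom`). On the potential of a triangulation it detects the diagonals which avoid `0`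
(`countHom_potential`), and these determine the triangulation.

*The associahedron.* A flip is the exchange of the two diagonals of a quadrilateral whose sides are
sides of the polygon or common diagonals of the two triangulations. It follows that the dissections
containing all common diagonals are the common part itself and the two triangulations, which
identifies flips with edges of the face poset. For a geometric polytope, every face is the convex
hull of the generating points it contains, hence compact; so the minimal faces are the extreme
points, and by the Krein-Milman theorem an edge is the segment joining its two vertices. The edge
graph is thus determined by the face poset.
-/

/-! ### Dissections and flips -/

/-- `IsChord D a b`: the vertices `a < b` of the `n`-gon are joined by a side of the polygon or by a
diagonal in `D`. Vertices are natural numbers here, so that the order relations between them can be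
decided by linear arithmetic. -/
def IsChord {n : ℕ} (D : Finset (Diagonal n)) (a b : ℕ) : Prop :=
  a < b ∧ b < n ∧ (b = a + 1 ∨ (a = 0 ∧ b + 1 = n) ∨ ∃ d ∈ D, d.fst.val = a ∧ d.snd.val = b)

theorem Diagonal.isChord {n : ℕ} {D : Finset (Diagonal n)} {d : Diagonal n} (hd : d ∈ D) :
    IsChord D d.fst d.snd :=
  ⟨by have := d.fst_succ_lt_snd; omega, d.snd.isLt, Or.inr (Or.inr ⟨d, hd, rfl, rfl⟩)⟩

theorem Diagonal.eq_of_val_eq {n : ℕ} {d e : Diagonal n} (h1 : d.fst.val = e.fst.val)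
    (h2 : d.snd.val = e.snd.val) : d = e :=
  Diagonal.ext (Fin.ext h1) (Fin.ext h2)

theorem Diagonal.crosses_iff {n : ℕ} (d e : Diagonal n) : d.Crosses e ↔
    (d.fst.val < e.fst.val ∧ e.fst.val < d.snd.val ∧ d.snd.val < e.snd.val) ∨
      (e.fst.val < d.fst.val ∧ d.fst.val < e.snd.val ∧ e.snd.val < d.snd.val) := Iff.rfl

theorem Diagonal.not_crosses_self {n : ℕ} (d : Diagonal n) : ¬d.Crosses d := by
  rw [Diagonal.crosses_iff]; omega

theorem Diagonal.Crosses.symm {n : ℕ} {d e : Diagonal n} (h : d.Crosses e) : e.Crosses d := by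
  rw [Diagonal.crosses_iff] at *; omega

/-- A chord which is not a side is a diagonal. -/
theorem IsChord.exists_diagonal {n : ℕ} {D : Finset (Diagonal n)} {a b : ℕ} (h : IsChord D a b)
    (h1 : b ≠ a + 1) (h2 : ¬(a = 0 ∧ b + 1 = n)) :
    ∃ d ∈ D, d.fst.val = a ∧ d.snd.val = b := by
  obtain ⟨_, _, h3 | h3 | h3⟩ := h
  exacts [absurd h3 h1, absurd h3 h2, h3]

theorem Diagonal.mem_iff_isChord {n : ℕ} {D : Finset (Diagonal n)} {d : Diagonal n} :
    d ∈ D ↔ IsChord D d.fst d.snd := by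
  refine ⟨Diagonal.isChord, fun h => ?_⟩
  have h1 := d.fst_succ_lt_snd
  obtain ⟨e, he, h2, h3⟩ := h.exists_diagonal (by omega) d.not_last_side
  rwa [Diagonal.eq_of_val_eq h2 h3] at he

/-- The chords of a dissection do not cross. -/
theorem Dissection.not_interleave {n : ℕ} (D : Dissection n) {a b c d : ℕ}
    (h1 : IsChord D.1 a b) (h2 : IsChord D.1 c d) : ¬(a < c ∧ c < b ∧ b < d) := by
  rintro ⟨hac, hcb, hbd⟩
  have := h2.2.1
  obtain ⟨x, hx, hxa, hxb⟩ := h1.exists_diagonal (by omega) (by omega)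
  obtain ⟨y, hy, hyc, hyd⟩ := h2.exists_diagonal (by omega) (by omega)
  exact D.2 x hx y hy (Or.inl (by simp only [Fin.lt_def]; omega))

/-- A maximal dissection contains every diagonal which crosses none of its diagonals. -/
theorem Dissection.mem_of_isMax {n : ℕ} {D : Dissection n} (hD : IsMax D) {d : Diagonal n}
    (h : ∀ e ∈ D.1, ¬d.Crosses e) : d ∈ D.1 := by
  have hins : ∀ x ∈ insert d D.1, ∀ y ∈ insert d D.1, ¬x.Crosses y := by
    intro x hx y hy
    rw [Finset.mem_insert] at hx hy
    rcases hx with rfl | hx <;> rcases hy with rfl | hy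
    · exact Diagonal.not_crosses_self _
    · exact h y hy
    · exact fun hc => h x hx hc.symm
    · exact D.2 x hx y hy
  have hle : D ≤ ⟨insert d D.1, hins⟩ := Finset.subset_insert d D.1
  exact hD hle (Finset.mem_insert_self d D.1)

theorem Dissection.isChord_of_isMax {n : ℕ} {D : Dissection n} (hD : IsMax D) {a b : ℕ}
    (hab : a < b) (hb : b < n)
    (h : ∀ x y, IsChord D.1 x y → ¬(x < a ∧ a < y ∧ y < b) ∧ ¬(a < x ∧ x < b ∧ b < y)) :
    IsChord D.1 a b := by
  by_cases h1 : b = a + 1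
  · exact ⟨hab, hb, Or.inl h1⟩
  by_cases h2 : a = 0 ∧ b + 1 = n
  · exact ⟨hab, hb, Or.inr (Or.inl h2)⟩
  refine ⟨hab, hb, Or.inr (Or.inr ⟨⟨⟨a, by omega⟩, ⟨b, hb⟩, by simp only; omega, h2⟩, ?_, rfl, rfl⟩)⟩
  refine Dissection.mem_of_isMax hD fun e he => ?_
  have h3 := h _ _ (Diagonal.isChord he)
  rw [Diagonal.crosses_iff]
  simp only
  omega

/-- In a triangulation, every chord `ac` which is not a side between consecutive vertices is the
base of a triangle `abc` with apex `b` between `a` and `c`: take for `b` the largest vertex in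
between which is joined to `a`. -/
theorem Dissection.exists_apex {n : ℕ} {D : Dissection n} (hD : IsMax D) {a c : ℕ}
    (hac : IsChord D.1 a c) (h : a + 1 < c) :
    ∃ b, a < b ∧ b < c ∧ IsChord D.1 a b ∧ IsChord D.1 b c := by
  classical
  have hcn := hac.2.1
  let s := (Finset.range c).filter fun b => IsChord D.1 a b
  have hs : s.Nonempty := ⟨a + 1, Finset.mem_filter.2
    ⟨Finset.mem_range.2 h, by omega, by omega, Or.inl rfl⟩⟩
  have hb := s.max'_mem hs
  have hmax : ∀ y, y < c → IsChord D.1 a y → y ≤ s.max' hs := fun y hy hay =>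
    s.le_max' y (Finset.mem_filter.2 ⟨Finset.mem_range.2 hy, hay⟩)
  generalize s.max' hs = b at hb hmax
  obtain ⟨hb1, hb2⟩ := Finset.mem_filter.1 hb
  rw [Finset.mem_range] at hb1
  refine ⟨b, hb2.1, hb1, hb2, Dissection.isChord_of_isMax hD hb1 hcn fun x y hxy => ?_⟩
  have hab := hb2.1
  have h1 := D.not_interleave hxy hac
  have h2 := D.not_interleave hac hxy
  have h3 := D.not_interleave hb2 hxy
  refine ⟨fun h4 => ?_, fun h4 => by omega⟩
  obtain rfl | h5 := eq_or_ne x a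
  · have := hmax y h4.2.2 hxy
    omega
  · omega

/-- `IsFlip S T i j k l`: the dissection `T` arises from `S` by replacing the diagonal `ik` of the
quadrilateral `ijkl` by its diagonal `jl`. -/
structure IsFlip {n : ℕ} (S T : Finset (Diagonal n)) (i j k l : ℕ) : Prop where
  lt_ij : i < j
  lt_jk : j < k
  lt_kl : k < l
  side_ij : IsChord S i j
  side_jk : IsChord S j k
  side_kl : IsChord S k l
  side_il : IsChord S i l
  diag_ik : IsChord S i k
  diag_jl : IsChord T j l
  chord_iff : ∀ a b, (IsChord S a b ∧ ¬(a = i ∧ b = k)) ↔ (IsChord T a b ∧ ¬(a = j ∧ b = l))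

theorem isFlip_of_sdiff {n : ℕ} {S T : Dissection n} (hS : IsMax S) {d e : Diagonal n}
    (hd : S.1 \ T.1 = {d}) (he : T.1 \ S.1 = {e}) (h1 : d.fst < e.fst) (h2 : e.fst < d.snd)
    (h3 : d.snd < e.snd) : IsFlip S.1 T.1 d.fst e.fst d.snd e.snd := by
  rw [Fin.lt_def] at h1 h2 h3
  have hdS : d ∈ S.1 ∧ d ∉ T.1 := Finset.mem_sdiff.1 (hd ▸ Finset.mem_singleton_self d)
  have heT : e ∈ T.1 ∧ e ∉ S.1 := Finset.mem_sdiff.1 (he ▸ Finset.mem_singleton_self e)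
  have hST : ∀ x ∈ S.1, x ≠ d → x ∈ T.1 := fun x hx hxd => by
    by_contra hxT
    exact hxd (Finset.mem_singleton.1 (hd ▸ Finset.mem_sdiff.2 ⟨hx, hxT⟩))
  have hTS : ∀ x ∈ T.1, x ≠ e → x ∈ S.1 := fun x hx hxe => by
    by_contra hxS
    exact hxe (Finset.mem_singleton.1 (he ▸ Finset.mem_sdiff.2 ⟨hx, hxS⟩))
  have hiff : ∀ a b, (IsChord S.1 a b ∧ ¬(a = d.fst.val ∧ b = d.snd.val)) ↔
      (IsChord T.1 a b ∧ ¬(a = e.fst.val ∧ b = e.snd.val)) := by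
    intro a b
    have hd1 := d.fst_succ_lt_snd
    have hd2 := d.not_last_side
    have he1 := e.fst_succ_lt_snd
    have he2 := e.not_last_side
    constructor
    · rintro ⟨⟨hab, hb, h | h | ⟨x, hx, hxa, hxb⟩⟩, hne⟩
      · exact ⟨⟨hab, hb, Or.inl h⟩, by omega⟩
      · exact ⟨⟨hab, hb, Or.inr (Or.inl h)⟩, by omega⟩
      · have hxT : x ∈ T.1 := hST x hx (by rintro rfl; omega)
        refine ⟨⟨hab, hb, Or.inr (Or.inr ⟨x, hxT, hxa, hxb⟩)⟩, fun hc => heT.2 ?_⟩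
        rwa [← Diagonal.eq_of_val_eq (d := x) (e := e) (by omega) (by omega)]
    · rintro ⟨⟨hab, hb, h | h | ⟨x, hx, hxa, hxb⟩⟩, hne⟩
      · exact ⟨⟨hab, hb, Or.inl h⟩, by omega⟩
      · exact ⟨⟨hab, hb, Or.inr (Or.inl h)⟩, by omega⟩
      · have hxS : x ∈ S.1 := hTS x hx (by rintro rfl; omega)
        refine ⟨⟨hab, hb, Or.inr (Or.inr ⟨x, hxS, hxa, hxb⟩)⟩, fun hc => hdS.2 ?_⟩
        rwa [← Diagonal.eq_of_val_eq (d := x) (e := d) (by omega) (by omega)]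
  have hdc := Diagonal.isChord hdS.1
  have hec := Diagonal.isChord heT.1
  -- a chord of `S` other than `d` crosses neither `d` nor `e`, hence crosses no side of the
  -- quadrilateral
  have key : ∀ x y, IsChord S.1 x y →
      x < y ∧ ((x = d.fst.val ∧ y = d.snd.val) ∨
      (¬(x < d.fst.val ∧ d.fst.val < y ∧ y < d.snd.val) ∧
      ¬(d.fst.val < x ∧ x < d.snd.val ∧ d.snd.val < y) ∧
      ¬(x < e.fst.val ∧ e.fst.val < y ∧ y < e.snd.val) ∧
      ¬(e.fst.val < x ∧ x < e.snd.val ∧ e.snd.val < y))) := by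
    intro x y hxy
    refine ⟨hxy.1, or_iff_not_imp_left.2 fun hne => ?_⟩
    have hT := ((hiff x y).1 ⟨hxy, hne⟩).1
    exact ⟨S.not_interleave hxy hdc, S.not_interleave hdc hxy, T.not_interleave hT hec,
      T.not_interleave hec hT⟩
  have hen := e.snd.isLt
  refine ⟨h1, h2, h3, ?_, ?_, ?_, ?_, hdc, hec, hiff⟩ <;>
  · refine Dissection.isChord_of_isMax hS (by omega) (by omega) fun x y hxy => ?_
    have := key x y hxy
    omega

theorem crosses_of_sdiff {n : ℕ} {S T : Dissection n} (hS : IsMax S) {d e : Diagonal n}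
    (hd : S.1 \ T.1 = {d}) (he : T.1 \ S.1 = {e}) : d.Crosses e := by
  have heT : e ∈ T.1 ∧ e ∉ S.1 := Finset.mem_sdiff.1 (he ▸ Finset.mem_singleton_self e)
  by_contra hc
  refine heT.2 (Dissection.mem_of_isMax hS fun x hx hex => ?_)
  by_cases hxT : x ∈ T.1
  · exact T.2 e heT.1 x hxT hex
  · have hxd : x = d := Finset.mem_singleton.1 (hd ▸ Finset.mem_sdiff.2 ⟨hx, hxT⟩)
    exact hc (hxd ▸ hex.symm)

/-- Up to exchanging the two triangulations, adjacency in the flip graph is a flip `ik → jl` in a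
quadrilateral `i < j < k < l`. -/
theorem exists_isFlip_of_adj {n : ℕ} {S T : PolygonTriangulation n} (h : (flipGraph n).Adj S T) :
    ∃ i j k l, IsFlip S.1.1 T.1.1 i j k l ∨ IsFlip T.1.1 S.1.1 i j k l := by
  obtain ⟨d, hd⟩ := Finset.card_eq_one.1 h.1
  obtain ⟨e, he⟩ := Finset.card_eq_one.1 h.2
  rcases crosses_of_sdiff S.2 hd he with ⟨h1, h2, h3⟩ | ⟨h1, h2, h3⟩
  · exact ⟨_, _, _, _, Or.inl (isFlip_of_sdiff S.2 hd he h1 h2 h3)⟩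
  · exact ⟨_, _, _, _, Or.inr (isFlip_of_sdiff T.2 he hd h1 h2 h3)⟩

/-- A dissection containing all common diagonals of two triangulations related by a flip has, apart
from these, only the two diagonals that are exchanged. -/
theorem IsFlip.mem_of_inter_subset {n : ℕ} {S T W : Dissection n} (hS : IsMax S) (hT : IsMax T)
    {i j k l : ℕ} (h : IsFlip S.1 T.1 i j k l) (hW : S.1 ∩ T.1 ⊆ W.1) {f : Diagonal n}
    (hf : f ∈ W.1) : f ∈ S.1 ∨ f ∈ T.1 := by
  by_contra! hc
  have h1 := h.lt_ij
  have h2 := h.lt_jk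
  have h3 := h.lt_kl
  have hcom : ∀ a b, IsChord S.1 a b → ¬(a = i ∧ b = k) → IsChord W.1 a b := by
    intro a b hab hne
    have habT := ((h.chord_iff a b).1 ⟨hab, hne⟩).1
    obtain ⟨hab1, hb, h4 | h4 | ⟨x, hx, hxa, hxb⟩⟩ := hab
    · exact ⟨hab1, hb, Or.inl h4⟩
    · exact ⟨hab1, hb, Or.inr (Or.inl h4)⟩
    · refine ⟨hab1, hb, Or.inr (Or.inr ⟨x, hW (Finset.mem_inter.2 ⟨hx, ?_⟩), hxa, hxb⟩)⟩
      rw [Diagonal.mem_iff_isChord, hxa, hxb]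
      exact habT
  have hfW := Diagonal.isChord hf
  have hij := hcom _ _ h.side_ij (by omega)
  have hjk := hcom _ _ h.side_jk (by omega)
  have hkl := hcom _ _ h.side_kl (by omega)
  have hil := hcom _ _ h.side_il (by omega)
  -- `f` crosses a diagonal of `S`, which can only be `ik`
  have hik : (f.fst.val < i ∧ i < f.snd.val ∧ f.snd.val < k) ∨
      (i < f.fst.val ∧ f.fst.val < k ∧ k < f.snd.val) := by
    by_contra hn
    refine hc.1 (Dissection.mem_of_isMax hS fun x hx hfx => ?_)
    rw [Diagonal.crosses_iff] at hfx
    by_cases hxe : x.fst.val = i ∧ x.snd.val = k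
    · omega
    · have hxW := hcom _ _ (Diagonal.isChord hx) hxe
      have := W.not_interleave hfW hxW
      have := W.not_interleave hxW hfW
      omega
  -- and a diagonal of `T`, which can only be `jl`
  have hjl : (f.fst.val < j ∧ j < f.snd.val ∧ f.snd.val < l) ∨
      (j < f.fst.val ∧ f.fst.val < l ∧ l < f.snd.val) := by
    by_contra hn
    refine hc.2 (Dissection.mem_of_isMax hT fun x hx hfx => ?_)
    rw [Diagonal.crosses_iff] at hfx
    by_cases hxe : x.fst.val = j ∧ x.snd.val = l
    · omega
    · have hxS := (h.chord_iff _ _).2 ⟨Diagonal.isChord hx, hxe⟩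
      have hxW := hcom _ _ hxS.1 hxS.2
      have := W.not_interleave hfW hxW
      have := W.not_interleave hxW hfW
      omega
  have := W.not_interleave hfW hij
  have := W.not_interleave hij hfW
  have := W.not_interleave hfW hjk
  have := W.not_interleave hjk hfW
  have := W.not_interleave hfW hkl
  have := W.not_interleave hkl hfW
  have := W.not_interleave hfW hil
  have := W.not_interleave hil hfW
  omega

/-! ### The edge graph of the face poset -/

/-- The intersection of two dissections. -/
def Dissection.inter {n : ℕ} (S T : Dissection n) : Dissection n :=
  ⟨S.1 ∩ T.1, fun d hd e he =>
    S.2 d (Finset.mem_inter.1 hd).1 e (Finset.mem_inter.1 he).1⟩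

/-- Two triangulations which differ by a flip are joined by an edge of the associahedron, the set of
their common diagonals. -/
theorem Dissection.Ici_inter_of_adj {n : ℕ} {S T : PolygonTriangulation n}
    (h : (flipGraph n).Adj S T) : Set.Ici (S.1.inter T.1) = {S.1, T.1, S.1.inter T.1} := by
  obtain ⟨d, hd⟩ := Finset.card_eq_one.1 h.1
  obtain ⟨e, he⟩ := Finset.card_eq_one.1 h.2
  ext W
  simp only [Set.mem_Ici, Set.mem_insert_iff, Set.mem_singleton_iff]
  constructor
  · intro (hW : S.1.1 ∩ T.1.1 ⊆ W.1)
    have hsub : ∀ f ∈ W.1, f ∈ S.1.1 ∨ f ∈ T.1.1 := by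
      intro f hf
      obtain ⟨i, j, k, l, hfl | hfl⟩ := exists_isFlip_of_adj h
      · exact hfl.mem_of_inter_subset S.2 T.2 hW hf
      · exact (hfl.mem_of_inter_subset T.2 S.2 (by rwa [Finset.inter_comm]) hf).symm
    have hmax : ∀ {A : Dissection n}, IsMax A → A ≤ W → W = A :=
      fun hA hAW => le_antisymm (hA hAW) hAW
    by_cases hdW : d ∈ W.1
    · refine Or.inl (hmax S.2 fun x hx => ?_)
      by_cases hxT : x ∈ T.1.1
      · exact hW (Finset.mem_inter.2 ⟨hx, hxT⟩)
      · have : x = d := Finset.mem_singleton.1 (hd ▸ Finset.mem_sdiff.2 ⟨hx, hxT⟩)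
        exact this ▸ hdW
    by_cases heW : e ∈ W.1
    · refine Or.inr (Or.inl (hmax T.2 fun x hx => ?_))
      by_cases hxS : x ∈ S.1.1
      · exact hW (Finset.mem_inter.2 ⟨hxS, hx⟩)
      · have : x = e := Finset.mem_singleton.1 (he ▸ Finset.mem_sdiff.2 ⟨hx, hxS⟩)
        exact this ▸ heW
    refine Or.inr (Or.inr (le_antisymm (fun f hf => Finset.mem_inter.2 ?_) hW))
    have h1 : f ∈ S.1.1 → f ∈ T.1.1 := fun hfS => by
      by_contra hfT
      exact hdW (Finset.mem_singleton.1 (hd ▸ Finset.mem_sdiff.2 ⟨hfS, hfT⟩) ▸ hf)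
    have h2 : f ∈ T.1.1 → f ∈ S.1.1 := fun hfT => by
      by_contra hfS
      exact heW (Finset.mem_singleton.1 (he ▸ Finset.mem_sdiff.2 ⟨hfT, hfS⟩) ▸ hf)
    have h3 := hsub f hf
    tauto
  · rintro (rfl | rfl | rfl)
    · exact Finset.inter_subset_left
    · exact Finset.inter_subset_right
    · exact le_rfl

/-- The two vertices of an edge of the associahedron differ in exactly one diagonal. -/
theorem Dissection.card_sdiff_of_Ici {n : ℕ} {S T W : Dissection n} (hS : IsMax S) (hT : IsMax T)
    (hne : S ≠ T) (hW : Set.Ici W = {S, T, W}) : (S.1 \ T.1).card = 1 := by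
  have hWS : W ≤ S := show S ∈ Set.Ici W by rw [hW]; simp
  have hWT : W ≤ T := show T ∈ Set.Ici W by rw [hW]; simp
  have hint : S.1 ∩ T.1 = W.1 := by
    have h1 : S.inter T ∈ Set.Ici W := Finset.subset_inter hWS hWT
    rw [hW] at h1
    rcases h1 with h1 | h1 | h1
    · exact absurd (hS.eq_of_le (h1.symm.le.trans Finset.inter_subset_right)) hne
    · exact absurd (hT.eq_of_le (h1.symm.le.trans Finset.inter_subset_left)).symm hne
    · exact congrArg Subtype.val h1
  have hns : ¬S.1 ⊆ T.1 := fun h => hne (hS.eq_of_le h)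
  obtain ⟨d, hdS, hdT⟩ := Finset.not_subset.1 hns
  have hsub : insert d W.1 ⊆ S.1 := Finset.insert_subset hdS hWS
  have hA : (⟨insert d W.1, fun x hx y hy => S.2 x (hsub hx) y (hsub hy)⟩ : Dissection n)
      ∈ Set.Ici W := Finset.subset_insert d W.1
  rw [hW] at hA
  have hSd : insert d W.1 = S.1 := by
    rcases hA with hA | hA | hA
    · exact congrArg Subtype.val hA
    · exact absurd (congrArg Subtype.val hA ▸ Finset.mem_insert_self d W.1) hdT
    · exact absurd (hWT (congrArg Subtype.val hA ▸ Finset.mem_insert_self d W.1)) hdT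
  refine Finset.card_eq_one.2 ⟨d, ?_⟩
  ext x
  rw [Finset.mem_sdiff, Finset.mem_singleton]
  constructor
  · rintro ⟨hx, hxT⟩
    rw [← hSd, Finset.mem_insert] at hx
    exact hx.resolve_right fun hxW => hxT (hWT hxW)
  · rintro rfl
    exact ⟨hdS, hdT⟩

/-- The minimal faces of the associahedron are the triangulations, and its edges are the flips. -/
def faceEdgeGraphIsoFlipGraph (n : ℕ) : faceEdgeGraph (AssociahedronFace n) ≃g flipGraph n where
  toFun v := ⟨OrderDual.ofDual v.1, v.2⟩
  invFun T := ⟨OrderDual.toDual T.1, T.2⟩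
  left_inv _ := rfl
  right_inv _ := rfl
  map_rel_iff' := by
    intro u v
    constructor
    · intro h
      refine ⟨fun huv => ?_, OrderDual.toDual (Dissection.inter u.1 v.1),
        Dissection.Ici_inter_of_adj h⟩
      subst huv
      exact (flipGraph n).loopless.irrefl _ h
    · rintro ⟨hne, W, hW⟩
      have hne' : OrderDual.ofDual u.1 ≠ OrderDual.ofDual v.1 := fun h => hne (Subtype.ext h)
      exact ⟨Dissection.card_sdiff_of_Ici u.2 v.2 hne' hW,
        Dissection.card_sdiff_of_Ici v.2 u.2 hne'.symm (W := OrderDual.ofDual W)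
          ((show Set.Ici (OrderDual.ofDual W) = _ from hW).trans (Set.insert_comm _ _ _))⟩

/-- Isomorphic face posets have isomorphic edge graphs. -/
def faceEdgeGraphCongr {F G : Type*} [PartialOrder F] [PartialOrder G] (φ : F ≃o G) :
    faceEdgeGraph F ≃g faceEdgeGraph G where
  toEquiv := φ.toEquiv.subtypeEquiv fun _ => φ.isMin_apply.symm
  map_rel_iff' := by
    intro u v
    refine and_congr (φ.toEquiv.subtypeEquiv fun _ => φ.isMin_apply.symm).injective.ne_iff ?_
    rw [← φ.toEquiv.exists_congr_right]
    refine exists_congr fun e => ?_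
    rw [← φ.injective.image_injective.eq_iff, OrderIso.image_Iic, Set.image_insert_eq,
      Set.image_insert_eq, Set.image_singleton]
    rfl

/-! ### The edge graph of a convex polytope -/

/-- A convex extreme subset of a convex hull is spanned by the generating points it contains: a
point of the set outside their hull would lie on an open segment ending outside the set. -/
theorem IsExtreme.eq_convexHull_inter {E : Type*} [AddCommGroup E] [Module ℝ E] {S A : Set E}
    (hA : IsExtreme ℝ (convexHull ℝ S) A) (hconv : Convex ℝ A) : A = convexHull ℝ (S ∩ A) := by
  refine Set.Subset.antisymm (fun x hx => ?_) (convexHull_min Set.inter_subset_right hconv)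
  have hxS := hA.subset hx
  have hsdiff : convexHull ℝ (S \ A) ⊆ convexHull ℝ S \ A :=
    convexHull_min (Set.sdiff_subset_sdiff_left (subset_convexHull ℝ S))
      (hA.convex_sdiff (convex_convexHull ℝ S))
  rcases (S ∩ A).eq_empty_or_nonempty with h1 | h1
  · have : S \ A = S := by rw [← Set.sdiff_self_inter, h1, Set.sdiff_empty]
    rw [this] at hsdiff
    exact absurd hx (hsdiff hxS).2
  rcases (S \ A).eq_empty_or_nonempty with h2 | h2
  · rwa [Set.inter_eq_left.2 (Set.sdiff_eq_empty.1 h2)]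
  rw [← Set.inter_union_sdiff S A, convexHull_union h1 h2, mem_convexJoin] at hxS
  obtain ⟨y, hy, z, hz, hxyz⟩ := hxS
  have hzA := hsdiff hz
  rw [← insert_endpoints_openSegment] at hxyz
  rcases hxyz with rfl | rfl | hxyz
  · exact hy
  · exact absurd hx hzA.2
  · exact absurd (hA.right_mem_of_mem_openSegment (convexHull_mono Set.inter_subset_left hy)
      hzA.1 hx hxyz) hzA.2

section Polytope

variable {d : ℕ} {K : Set (EuclideanSpace ℝ (Fin d))}

theorem IsConvexPolytope.isCompact (hK : IsConvexPolytope K) : IsCompact K := by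
  obtain ⟨S, hS, rfl⟩ := hK
  exact hS.isCompact_convexHull ℝ

theorem IsConvexPolytope.of_face (hK : IsConvexPolytope K) (A : PolytopeFace K) :
    IsConvexPolytope A.1 := by
  obtain ⟨S, hS, rfl⟩ := hK
  exact ⟨S ∩ A.1, hS.subset Set.inter_subset_left, A.2.2.2.eq_convexHull_inter A.2.2.1⟩

/-- The face of a convex set consisting of an extreme point. -/
def PolytopeFace.ofExtremePoint (x : K.extremePoints ℝ) : PolytopeFace K :=
  ⟨{x.1}, Set.singleton_nonempty _, convex_singleton _, isExtreme_singleton.2 x.2⟩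

theorem PolytopeFace.isMin_ofExtremePoint (x : K.extremePoints ℝ) :
    IsMin (PolytopeFace.ofExtremePoint x) := by
  intro A (hA : A.1 ⊆ {x.1})
  exact (Set.Nonempty.subset_singleton_iff A.2.1).1 hA |>.ge

theorem PolytopeFace.ofExtremePoint_injective :
    Function.Injective (PolytopeFace.ofExtremePoint (K := K)) := fun _ _ h =>
  Subtype.ext (Set.singleton_injective (congrArg Subtype.val h))

theorem PolytopeFace.exists_extremePoint_le (hK : IsConvexPolytope K) (A : PolytopeFace K) :
    ∃ x : K.extremePoints ℝ, PolytopeFace.ofExtremePoint x ≤ A := by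
  obtain ⟨x, hx⟩ := (hK.of_face A).isCompact.extremePoints_nonempty A.2.1
  exact ⟨⟨x, A.2.2.2.extremePoints_subset_extremePoints hx⟩,
    Set.singleton_subset_iff.2 hx.1⟩

/-- An edge of a polytope with vertices `x` and `y` is the segment `xy`, by the Krein-Milman
theorem. -/
theorem PolytopeFace.eq_segment (hK : IsConvexPolytope K) {x y : K.extremePoints ℝ} (hxy : x ≠ y)
    {A : PolytopeFace K} (hA : Set.Iic A =
      {PolytopeFace.ofExtremePoint x, PolytopeFace.ofExtremePoint y, A}) :
    A.1 = segment ℝ x.1 y.1 := by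
  have hxA : PolytopeFace.ofExtremePoint x ≤ A := show _ ∈ Set.Iic A by rw [hA]; simp
  have hyA : PolytopeFace.ofExtremePoint y ≤ A := show _ ∈ Set.Iic A by rw [hA]; simp
  have hxA' : x.1 ∈ A.1 := Set.singleton_subset_iff.1 hxA
  have hyA' : y.1 ∈ A.1 := Set.singleton_subset_iff.1 hyA
  refine Set.Subset.antisymm ?_ (A.2.2.1.segment_subset hxA' hyA')
  have hext : A.1.extremePoints ℝ ⊆ {x.1, y.1} := by
    intro z hz
    let z' : K.extremePoints ℝ := ⟨z, A.2.2.2.extremePoints_subset_extremePoints hz⟩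
    have hzA : PolytopeFace.ofExtremePoint z' ∈ Set.Iic A := Set.singleton_subset_iff.2 hz.1
    rw [hA] at hzA
    rcases hzA with h | h | h
    · exact Or.inl (congrArg Subtype.val (PolytopeFace.ofExtremePoint_injective h))
    · exact Or.inr (congrArg Subtype.val (PolytopeFace.ofExtremePoint_injective h))
    · have hAz : A.1 = {z} := (congrArg Subtype.val h).symm
      rw [hAz] at hxA' hyA'
      exact absurd (Subtype.ext (hxA'.trans hyA'.symm)) hxy
  rw [← closure_convexHull_extremePoints (hK.of_face A).isCompact A.2.2.1]
  refine closure_minimal ((convexHull_mono hext).trans_eq (convexHull_pair _ _)) ?_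
  rw [← convexHull_pair]
  exact (Set.toFinite _).isClosed_convexHull ℝ

/-- If the segment joining two vertices is a face, its proper faces are its ends. -/
theorem PolytopeFace.Iic_segment {x y : K.extremePoints ℝ}
    {A : PolytopeFace K} (hA : A.1 = segment ℝ x.1 y.1) : Set.Iic A =
      {PolytopeFace.ofExtremePoint x, PolytopeFace.ofExtremePoint y, A} := by
  have hxA : x.1 ∈ A.1 := hA ▸ left_mem_segment ℝ _ _
  have hyA : y.1 ∈ A.1 := hA ▸ right_mem_segment ℝ _ _
  ext B
  simp only [Set.mem_Iic, Set.mem_insert_iff, Set.mem_singleton_iff]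
  constructor
  · intro (hB : B.1 ⊆ A.1)
    by_cases hBxy : x.1 ∈ B.1 ∧ y.1 ∈ B.1
    · refine Or.inr (Or.inr (le_antisymm hB ?_))
      exact hA.subset.trans (B.2.2.1.segment_subset hBxy.1 hBxy.2)
    have hends : B.1 ⊆ {x.1, y.1} := by
      intro z hz
      have hzA := hB hz
      rw [hA, ← insert_endpoints_openSegment] at hzA
      rcases hzA with h | h | h
      · exact Or.inl h
      · exact Or.inr h
      · exact absurd ⟨B.2.2.2.left_mem_of_mem_openSegment x.2.1 y.2.1 hz h,
          B.2.2.2.right_mem_of_mem_openSegment x.2.1 y.2.1 hz h⟩ hBxy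
    by_cases hx : x.1 ∈ B.1
    · refine Or.inl (Subtype.ext ((Set.Nonempty.subset_singleton_iff B.2.1).1 fun z hz => ?_))
      rcases hends hz with h | h
      · exact h
      · exact absurd ⟨hx, (show z = y.1 from h) ▸ hz⟩ hBxy
    · refine Or.inr (Or.inl (Subtype.ext
        ((Set.Nonempty.subset_singleton_iff B.2.1).1 fun z hz => ?_)))
      rcases hends hz with h | h
      · exact absurd ((show z = x.1 from h) ▸ hz) hx
      · exact h
  · rintro (rfl | rfl | rfl)
    · exact Set.singleton_subset_iff.2 hxA
    · exact Set.singleton_subset_iff.2 hyA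
    · exact le_rfl

/-- The edge graph of a convex polytope is the edge graph of its face poset: the minimal faces are
the extreme points, and the edges are segments. -/
noncomputable def polytopeEdgeGraphIso (hK : IsConvexPolytope K) :
    polytopeEdgeGraph K ≃g faceEdgeGraph (PolytopeFace K) where
  toEquiv := Equiv.ofBijective
    (fun x => ⟨PolytopeFace.ofExtremePoint x, PolytopeFace.isMin_ofExtremePoint x⟩) <| by
      refine ⟨fun x y h => PolytopeFace.ofExtremePoint_injective (congrArg Subtype.val h), ?_⟩
      rintro ⟨A, hA⟩
      obtain ⟨x, hx⟩ := PolytopeFace.exists_extremePoint_le hK A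
      exact ⟨x, Subtype.ext (hA.eq_of_le hx)⟩
  map_rel_iff' := by
    intro x y
    constructor
    · rintro ⟨hne, A, hA⟩
      have hxy : x ≠ y := by rintro rfl; exact hne rfl
      refine ⟨hxy, ?_⟩
      rw [← PolytopeFace.eq_segment hK hxy hA]
      exact A.2.2.2
    · rintro ⟨hxy, h⟩
      refine ⟨fun h' => hxy (PolytopeFace.ofExtremePoint_injective (congrArg Subtype.val h')),
        ⟨segment ℝ x.1 y.1, ⟨x.1, left_mem_segment ℝ _ _⟩, convex_segment _ _, h⟩, ?_⟩
      exact PolytopeFace.Iic_segment rfl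

end Polytope

/-! ### Gale diagrams of order five -/

theorem planeDet_galeVertex (l p q : ℕ) :
    planeDet (galeVertex l p) (galeVertex l q) = Real.sin (Real.pi * ((q : ℝ) - p) / l) := by
  have h : ∀ r : ℕ, galeVertex l r = Complex.exp ((Real.pi * r / l : ℝ) * Complex.I) := by
    intro r
    rw [galeVertex]
    congr 1
    push_cast
    ring
  have h2 : Real.pi * ((q : ℝ) - p) / l = Real.pi * q / l - Real.pi * p / l := by ring
  rw [planeDet, h, h, Complex.exp_ofReal_mul_I_re, Complex.exp_ofReal_mul_I_re,
    Complex.exp_ofReal_mul_I_im, Complex.exp_ofReal_mul_I_im, h2, Real.sin_sub]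
  ring

theorem planeDet_swap (u v : ℂ) : planeDet v u = -planeDet u v := by
  unfold planeDet; ring

theorem planeDet_galeVertex_pos {l p q : ℕ} (h1 : p < q) (h2 : q < p + l) :
    0 < planeDet (galeVertex l p) (galeVertex l q) := by
  have hl : (0 : ℝ) < l := by exact_mod_cast (by omega : 0 < l)
  have hpq : (0 : ℝ) < (q : ℝ) - p := sub_pos.2 (by exact_mod_cast h1)
  have hql : (q : ℝ) - p < l := by
    have : (q : ℝ) < p + l := by exact_mod_cast h2
    linarith
  rw [planeDet_galeVertex]
  refine Real.sin_pos_of_pos_of_lt_pi (by have := Real.pi_pos; positivity) ?_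
  rw [div_lt_iff₀ hl]
  exact mul_lt_mul_of_pos_left hql Real.pi_pos

theorem planeDet_galeVertex_neg {l p q : ℕ} (h1 : p + l < q) (h2 : q < p + 2 * l) :
    planeDet (galeVertex l p) (galeVertex l q) < 0 := by
  have hl : (0 : ℝ) < l := by exact_mod_cast (by omega : 0 < l)
  have hpq : (l : ℝ) < (q : ℝ) - p := by
    have : (p : ℝ) + l < q := by exact_mod_cast h1
    linarith
  have hql : (q : ℝ) - p < 2 * l := by
    have : (q : ℝ) < p + 2 * l := by exact_mod_cast h2
    linarith
  have h3 : Real.pi * ((q : ℝ) - p) / l = Real.pi * ((q : ℝ) - p - l) / l + Real.pi := by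
    field_simp; ring
  rw [planeDet_galeVertex, h3, Real.sin_add_pi, neg_lt_zero]
  refine Real.sin_pos_of_pos_of_lt_pi
    (div_pos (mul_pos Real.pi_pos (by linarith)) hl) ?_
  rw [div_lt_iff₀ hl]
  exact mul_lt_mul_of_pos_left (by linarith) Real.pi_pos

namespace StandardGaleDiagram

theorem pos_ne_add {l : ℕ} (Y : StandardGaleDiagram l) (i j : Fin l) : Y.pos j ≠ Y.pos i + l := by
  intro h
  have hl : (l : ℝ) ≠ 0 := by exact_mod_cast (Nat.zero_lt_of_lt i.isLt).ne'
  have hij : i ≠ j := by rintro rfl; have := i.isLt; omega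
  refine Y.diameter i j hij ?_
  rw [planeDet_galeVertex, h]
  push_cast
  rw [add_sub_cancel_left, mul_div_assoc, div_self hl, mul_one, Real.sin_pi]

theorem mem_left_iff {l : ℕ} (Y : StandardGaleDiagram l) (i j : Fin l) : j ∈ Y.left i ↔
    (i < j ∧ Y.pos j < Y.pos i + l) ∨ (j < i ∧ Y.pos j + l < Y.pos i) := by
  have hi := Y.pos_lt i
  have hj := Y.pos_lt j
  have hne := Y.pos_ne_add i j
  have hne' := Y.pos_ne_add j i
  rw [left, Finset.mem_filter, point, point, and_iff_right (Finset.mem_univ j)]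
  rcases lt_trichotomy i j with h | rfl | h
  · have hlt := Y.pos_strictMono h
    by_cases h2 : Y.pos j < Y.pos i + l
    · simp [h, h2, planeDet_galeVertex_pos hlt h2]
    · have := planeDet_galeVertex_neg (l := l) (p := Y.pos i) (q := Y.pos j) (by omega) (by omega)
      exact iff_of_false this.not_gt (by omega)
  · have : planeDet (galeVertex l (Y.pos i)) (galeVertex l (Y.pos i)) = 0 := by
      unfold planeDet; ring
    simp [this]
  · have hlt := Y.pos_strictMono h
    rw [planeDet_swap]
    by_cases h2 : Y.pos i < Y.pos j + l
    · have := planeDet_galeVertex_pos hlt h2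
      simp only [Left.neg_pos_iff, h.not_gt, false_and, false_or, h, true_and]
      exact ⟨fun h3 => absurd h3 this.not_gt, fun h3 => by omega⟩
    · have := planeDet_galeVertex_neg (l := l) (p := Y.pos j) (q := Y.pos i) (by omega) (by omega)
      simp only [Left.neg_pos_iff, h.not_gt, false_and, false_or, h, true_and, this, true_iff]
      omega

theorem mem_right_iff {l : ℕ} (Y : StandardGaleDiagram l) (i j : Fin l) :
    j ∈ Y.right i ↔ j ≠ i ∧ j ∉ Y.left i := by
  have h1 : j ∈ Y.right i ∪ Y.left i ↔ j ∈ ({i}ᶜ : Finset (Fin l)) := by rw [Y.right_union_left i]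
  have h2 : j ∈ Y.right i → j ∉ Y.left i :=
    fun h => Finset.disjoint_left.1 (Y.disjoint_right_left i) h
  simp only [Finset.mem_union, Finset.mem_compl, Finset.mem_singleton] at h1
  tauto

/-- Up to the position of the points, the only standard Gale diagram of order five is the regular
pentagon: the half-plane condition forces two points on either side of every diameter. -/
theorem left_right_eq (Y : StandardGaleDiagram 5) (i : Fin 5) :
    Y.left i = {i + 1, i + 2} ∧ Y.right i = {i + 3, i + 4} := by
  have h01 := Y.pos_strictMono (show (0 : Fin 5) < 1 by decide)
  have h12 := Y.pos_strictMono (show (1 : Fin 5) < 2 by decide)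
  have h23 := Y.pos_strictMono (show (2 : Fin 5) < 3 by decide)
  have h34 := Y.pos_strictMono (show (3 : Fin 5) < 4 by decide)
  have hl := fun i => Y.mem_left_iff i
  have hr := fun i j => Y.mem_right_iff i j
  have hL := fun i a => Finset.exists_mem_ne (Y.two_le_card_left i) a
  have hR := fun i a => Finset.exists_mem_ne (Y.two_le_card_right i) a
  have h1 : Y.pos 2 < Y.pos 0 + 5 := by
    obtain ⟨j, hj, hne⟩ := hL 0 1
    rw [hl] at hj
    fin_cases j <;> simp at hj hne <;> omega
  have h2 : Y.pos 0 + 5 ≤ Y.pos 3 := by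
    obtain ⟨j, hj, hne⟩ := hR 0 4
    rw [hr, hl] at hj
    fin_cases j <;> simp at hj hne <;> omega
  have h3 : Y.pos 3 < Y.pos 1 + 5 := by
    obtain ⟨j, hj, hne⟩ := hL 1 2
    rw [hl] at hj
    fin_cases j <;> simp at hj hne <;> omega
  have h4 : Y.pos 1 + 5 ≤ Y.pos 4 := by
    obtain ⟨j, hj, hne⟩ := hR 1 0
    rw [hr, hl] at hj
    fin_cases j <;> simp at hj hne <;> omega
  have h5 : Y.pos 4 < Y.pos 2 + 5 := by
    obtain ⟨j, hj, hne⟩ := hL 2 3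
    rw [hl] at hj
    fin_cases j <;> simp at hj hne <;> omega
  have h6 := Y.pos_ne_add 0 3
  have h7 := Y.pos_ne_add 1 4
  have hleft : Y.left i = {i + 1, i + 2} := by
    ext j
    rw [hl]
    fin_cases i <;> fin_cases j <;> simp <;> omega
  refine ⟨hleft, ?_⟩
  ext j
  rw [hr, hleft, Finset.mem_insert, Finset.mem_insert, Finset.mem_singleton,
    Finset.mem_singleton]
  omega

/-- Five numbers behaving like the values of a linear functional at the vertices of a regular
pentagon vanish if at most one of them is positive. -/
theorem pentagon_eq_zero {t f₀ f₁ f₂ f₃ f₄ : ℝ} (ht : 0 < t) (e₀ : f₂ + f₃ = -t * f₀)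
    (e₁ : f₃ + f₄ = -t * f₁) (e₄ : f₁ + f₂ = -t * f₄)
    (h₁ : f₁ ≤ 0) (h₂ : f₂ ≤ 0) (h₃ : f₃ ≤ 0) (h₄ : f₄ ≤ 0) :
    f₀ = 0 ∧ f₁ = 0 ∧ f₂ = 0 ∧ f₃ = 0 ∧ f₄ = 0 := by
  have m₁ := mul_nonpos_of_nonneg_of_nonpos ht.le h₁
  have m₄ := mul_nonpos_of_nonneg_of_nonpos ht.le h₄
  have z₁ : f₁ = 0 := by linarith
  have z₂ : f₂ = 0 := by linarith
  have z₃ : f₃ = 0 := by linarith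
  have z₄ : f₄ = 0 := by linarith
  refine ⟨?_, z₁, z₂, z₃, z₄⟩
  rw [z₂, z₃, add_zero, zero_eq_mul] at e₀
  exact e₀.resolve_left (by linarith)

/-- Every open half-plane contains two vertices of the regular pentagon. The linear functional `g`
defining it satisfies `g (y_{s+2}) + g (y_{s-2}) = -2 cos (π / 5) g (y_s)` at the vertices `y_s`, so
`pentagon_eq_zero` applies if it is positive at no vertex other than `y_t`. -/
theorem two_le_card_regularPentagon (u : ℂ) (hu : u ≠ 0) :
    2 ≤ (Finset.univ.filter fun j : Fin 5 => 0 < planeDet u (galeVertex 5 (2 * j.val))).card := by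
  by_contra! hc
  obtain ⟨t, ht⟩ := Finset.card_le_one_iff_subset_singleton.1 (Nat.lt_succ_iff.1 hc)
  set g : ℝ → ℝ := fun x => u.re * Real.sin x - u.im * Real.cos x with hg
  have hf : ∀ j : Fin 5, planeDet u (galeVertex 5 (2 * j.val)) = g (2 * Real.pi * j.val / 5) := by
    intro j
    have : galeVertex 5 (2 * j.val) =
        Complex.exp ((2 * Real.pi * j.val / 5 : ℝ) * Complex.I) := by
      rw [galeVertex]; congr 1; push_cast; ring
    rw [planeDet, this, Complex.exp_ofReal_mul_I_re, Complex.exp_ofReal_mul_I_im]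
  have hle : ∀ j : Fin 5, j ≠ t → g (2 * Real.pi * j.val / 5) ≤ 0 := by
    intro j hj
    by_contra! h
    rw [← hf] at h
    exact hj (Finset.mem_singleton.1 (ht (Finset.mem_filter.2 ⟨Finset.mem_univ j, h⟩)))
  have hper : ∀ x, g (x + 2 * Real.pi) = g x := fun x => by
    simp only [hg, Real.sin_add_two_pi, Real.cos_add_two_pi]
  have hcos : 0 < 2 * Real.cos (Real.pi / 5) := by
    have := Real.pi_pos
    exact mul_pos two_pos (Real.cos_pos_of_mem_Ioo ⟨by linarith, by linarith⟩)
  have hrel : ∀ x, g (x + 4 * Real.pi / 5) + g (x - 4 * Real.pi / 5) =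
      -(2 * Real.cos (Real.pi / 5)) * g x := by
    intro x
    have h1 : 4 * Real.pi / 5 = Real.pi - Real.pi / 5 := by ring
    simp only [hg, Real.sin_add, Real.sin_sub, Real.cos_add, Real.cos_sub]
    rw [h1, Real.cos_pi_sub, Real.sin_pi_sub]
    ring
  have v0 := hle 0
  have v1 := hle 1
  have v2 := hle 2
  have v3 := hle 3
  have v4 := hle 4
  have e0 := hrel 0
  have e1 := hrel (2 * Real.pi / 5)
  have e2 := hrel (4 * Real.pi / 5)
  have e3 := hrel (6 * Real.pi / 5)
  have e4 := hrel (8 * Real.pi / 5)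
  have a0 : g (2 * Real.pi * (0 : Fin 5).val / 5) = g 0 := by norm_num
  have a1 : g (2 * Real.pi * (1 : Fin 5).val / 5) = g (2 * Real.pi / 5) := by norm_num
  have a2 : g (2 * Real.pi * (2 : Fin 5).val / 5) = g (4 * Real.pi / 5) := by
    congr 1; norm_num; ring
  have a3 : g (2 * Real.pi * (3 : Fin 5).val / 5) = g (6 * Real.pi / 5) := by
    congr 1; norm_num; ring
  have a4 : g (2 * Real.pi * (4 : Fin 5).val / 5) = g (8 * Real.pi / 5) := by
    congr 1; norm_num; ring
  rw [a0] at v0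
  rw [a1] at v1
  rw [a2] at v2
  rw [a3] at v3
  rw [a4] at v4
  rw [show (0 : ℝ) + 4 * Real.pi / 5 = 4 * Real.pi / 5 by ring,
    ← hper (0 - 4 * Real.pi / 5), show (0 : ℝ) - 4 * Real.pi / 5 + 2 * Real.pi = 6 * Real.pi / 5 by
      ring] at e0
  rw [show 2 * Real.pi / 5 + 4 * Real.pi / 5 = 6 * Real.pi / 5 by ring,
    ← hper (2 * Real.pi / 5 - _), show 2 * Real.pi / 5 - 4 * Real.pi / 5 + 2 * Real.pi =
      8 * Real.pi / 5 by ring] at e1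
  rw [show 4 * Real.pi / 5 + 4 * Real.pi / 5 = 8 * Real.pi / 5 by ring,
    show 4 * Real.pi / 5 - 4 * Real.pi / 5 = 0 by ring] at e2
  rw [show 6 * Real.pi / 5 + 4 * Real.pi / 5 = 0 + 2 * Real.pi by ring, hper,
    show 6 * Real.pi / 5 - 4 * Real.pi / 5 = 2 * Real.pi / 5 by ring] at e3
  rw [show 8 * Real.pi / 5 + 4 * Real.pi / 5 = 2 * Real.pi / 5 + 2 * Real.pi by ring, hper,
    show 8 * Real.pi / 5 - 4 * Real.pi / 5 = 4 * Real.pi / 5 by ring] at e4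
  have key : g 0 = 0 ∧ g (2 * Real.pi / 5) = 0 := by
    fin_cases t
    · have := pentagon_eq_zero hcos e0 e1 e4 (v1 (by decide)) (v2 (by decide)) (v3 (by decide))
        (v4 (by decide))
      exact ⟨this.1, this.2.1⟩
    · have := pentagon_eq_zero hcos e1 (by linarith) (by linarith)
        (v2 (by decide)) (v3 (by decide)) (v4 (by decide)) (v0 (by decide))
      exact ⟨this.2.2.2.2, this.1⟩
    · have := pentagon_eq_zero hcos e2 (by linarith) (by linarith)
        (v3 (by decide)) (v4 (by decide)) (v0 (by decide)) (v1 (by decide))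
      exact ⟨this.2.2.2.1, this.2.2.2.2⟩
    · have := pentagon_eq_zero hcos e3 (by linarith) (by linarith)
        (v4 (by decide)) (v0 (by decide)) (v1 (by decide)) (v2 (by decide))
      exact ⟨this.2.2.1, this.2.2.2.1⟩
    · have := pentagon_eq_zero hcos e4 (by linarith) (by linarith)
        (v0 (by decide)) (v1 (by decide)) (v2 (by decide)) (v3 (by decide))
      exact ⟨this.2.1, this.2.2.1⟩
  have him : u.im = 0 := by simpa [hg] using key.1
  have hsin : Real.sin (2 * Real.pi / 5) ≠ 0 := by
    have := Real.pi_pos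
    exact (Real.sin_pos_of_pos_of_lt_pi (by linarith) (by linarith)).ne'
  have hre : u.re = 0 := by simpa [hg, him, hsin] using key.2
  exact hu (Complex.ext hre him)

/-- The regular pentagon. -/
noncomputable def regularPentagon : StandardGaleDiagram 5 where
  pos j := 2 * j.val
  pos_strictMono i j h := by rw [Fin.lt_def] at h; simp only; omega
  pos_lt j := by have := j.isLt; omega
  diameter i j hij := by
    have hi := i.isLt
    have hj := j.isLt
    rcases lt_or_gt_of_ne hij with h | h <;> rw [Fin.lt_def] at h
    · by_cases h2 : 2 * j.val < 2 * i.val + 5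
      · exact (planeDet_galeVertex_pos (by omega) h2).ne'
      · exact (planeDet_galeVertex_neg (by omega) (by omega)).ne
    · rw [planeDet_swap, neg_ne_zero]
      by_cases h2 : 2 * i.val < 2 * j.val + 5
      · exact (planeDet_galeVertex_pos (by omega) h2).ne'
      · exact (planeDet_galeVertex_neg (by omega) (by omega)).ne
  halfPlane := two_le_card_regularPentagon

end StandardGaleDiagram

/-! ### Generators and relations of `Γ_n^4` -/

/-- `p`, `q`, `r`, `s` are four distinct vertices of the `n`-gon. -/
def IsQuad (n p q r s : ℕ) : Prop :=
  (p < n ∧ q < n ∧ r < n ∧ s < n) ∧ p ≠ q ∧ p ≠ r ∧ p ≠ s ∧ q ≠ r ∧ q ≠ s ∧ r ≠ s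

/-- The index of the generator which stands for the flip `pq → rs`. -/
def IsQuad.pachnerType {n p q r s : ℕ} (h : IsQuad n p q r s) : PachnerType n 4 where
  P := {⟨r, h.1.2.2.1⟩, ⟨s, h.1.2.2.2⟩}
  Q := {⟨p, h.1.1⟩, ⟨q, h.1.2.1⟩}
  disjoint := by
    obtain ⟨h1, h2⟩ := h
    simp only [Finset.disjoint_insert_left, Finset.disjoint_singleton_left, Finset.mem_insert,
      Finset.mem_singleton, Fin.mk.injEq]
    omega
  card_union := by
    obtain ⟨h1, h2⟩ := h
    rw [Finset.insert_union, Finset.singleton_union, Finset.card_insert_of_notMem,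
      Finset.card_insert_of_notMem, Finset.card_pair] <;>
    simp only [ne_eq, Finset.mem_insert, Finset.mem_singleton, Fin.mk.injEq] <;> omega
  two_le_card_P := by
    obtain ⟨h1, h2⟩ := h
    rw [Finset.card_pair (by simp only [ne_eq, Fin.mk.injEq]; omega)]
  two_le_card_Q := by
    obtain ⟨h1, h2⟩ := h
    rw [Finset.card_pair (by simp only [ne_eq, Fin.mk.injEq]; omega)]

open Classical in
/-- The generator of `Γ_n^4` which stands for the flip replacing the diagonal `pq` by `rs`. It is
`1` if `p`, `q`, `r`, `s` are not four distinct vertices; in particular `flipGen n 0 c 0 b = 1`. -/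
noncomputable def flipGen (n p q r s : ℕ) : GammaGroup n 4 :=
  if h : IsQuad n p q r s then PresentedGroup.of h.pachnerType else 1

theorem flipGen_of_isQuad {n p q r s : ℕ} (h : IsQuad n p q r s) :
    flipGen n p q r s = PresentedGroup.of h.pachnerType := dif_pos h

theorem flipGen_zero (n c b : ℕ) : flipGen n 0 c 0 b = 1 := dif_neg fun h => h.2.2.1 rfl

theorem flipGen_swap_left (n p q r s : ℕ) : flipGen n p q r s = flipGen n q p r s := by
  by_cases h : IsQuad n p q r s
  · have h' : IsQuad n q p r s := by unfold IsQuad at *; omega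
    rw [flipGen_of_isQuad h, flipGen_of_isQuad h']
    congr 1
    exact PachnerType.ext rfl (Finset.pair_comm _ _)
  · rw [flipGen, flipGen, dif_neg h, dif_neg (by unfold IsQuad at *; omega)]

theorem flipGen_swap_right (n p q r s : ℕ) : flipGen n p q r s = flipGen n p q s r := by
  by_cases h : IsQuad n p q r s
  · have h' : IsQuad n p q s r := by unfold IsQuad at *; omega
    rw [flipGen_of_isQuad h, flipGen_of_isQuad h']
    congr 1
    exact PachnerType.ext (Finset.pair_comm _ _) rfl
  · rw [flipGen, flipGen, dif_neg h, dif_neg (by unfold IsQuad at *; omega)]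

theorem flipGen_mul_flipGen (n p q r s : ℕ) : flipGen n p q r s * flipGen n r s p q = 1 := by
  by_cases h : IsQuad n p q r s
  · have h' : IsQuad n r s p q := by unfold IsQuad at *; omega
    rw [flipGen_of_isQuad h, flipGen_of_isQuad h']
    exact PresentedGroup.one_of_mem (IsGammaRelator.inverse h'.pachnerType)
  · rw [flipGen, flipGen, dif_neg h, dif_neg (by unfold IsQuad at *; omega), one_mul]

theorem not_pair_subset {n : ℕ} {x y a b c d : Fin n}
    (h : (x.val ≠ a ∧ x.val ≠ b ∧ x.val ≠ c ∧ x.val ≠ d) ∨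
      (y.val ≠ a ∧ y.val ≠ b ∧ y.val ≠ c ∧ y.val ≠ d)) :
    ¬({x, y} : Finset (Fin n)) ⊆ {c, d} ∪ {a, b} := by
  simp only [Finset.insert_subset_iff, Finset.singleton_subset_iff, Finset.mem_union,
    Finset.mem_insert, Finset.mem_singleton, Fin.ext_iff]
  rintro ⟨hx, hy⟩
  rcases h with ⟨ha, hb, hc, hd⟩ | ⟨ha, hb, hc, hd⟩
  · simp only [ha, hb, hc, hd, or_self] at hx
  · simp only [ha, hb, hc, hd, or_self] at hy

/-- Flips in quadrilaterals neither of which has a diagonal of the other on its vertex set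
commute. -/
theorem flipGen_commute {n p q r s p' q' r' s' : ℕ}
    (h1 : (p ≠ p' ∧ p ≠ q' ∧ p ≠ r' ∧ p ≠ s') ∨ (q ≠ p' ∧ q ≠ q' ∧ q ≠ r' ∧ q ≠ s'))
    (h2 : (r ≠ p' ∧ r ≠ q' ∧ r ≠ r' ∧ r ≠ s') ∨ (s ≠ p' ∧ s ≠ q' ∧ s ≠ r' ∧ s ≠ s'))
    (h3 : (p' ≠ p ∧ p' ≠ q ∧ p' ≠ r ∧ p' ≠ s) ∨ (q' ≠ p ∧ q' ≠ q ∧ q' ≠ r ∧ q' ≠ s))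
    (h4 : (r' ≠ p ∧ r' ≠ q ∧ r' ≠ r ∧ r' ≠ s) ∨ (s' ≠ p ∧ s' ≠ q ∧ s' ≠ r ∧ s' ≠ s)) :
    Commute (flipGen n p q r s) (flipGen n p' q' r' s') := by
  by_cases h : IsQuad n p q r s
  swap
  · rw [flipGen, dif_neg h]
    exact Commute.one_left _
  by_cases h' : IsQuad n p' q' r' s'
  swap
  · rw [flipGen, flipGen, dif_neg h']
    exact Commute.one_right _
  rw [flipGen_of_isQuad h, flipGen_of_isQuad h']
  have hlt : ∀ A B : Finset (Fin n), ¬A ⊆ B → (A ∩ B).card < A.card := fun A B hAB =>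
    Finset.card_lt_card ⟨Finset.inter_subset_left, fun hle =>
      hAB (hle.trans Finset.inter_subset_right)⟩
  have hfar : h.pachnerType.IsFar h'.pachnerType :=
    ⟨hlt _ _ (not_pair_subset h2), hlt _ _ (not_pair_subset h1),
      hlt _ _ (not_pair_subset h4), hlt _ _ (not_pair_subset h3)⟩
  exact PresentedGroup.mk_eq_mk_of_mul_inv_mem (IsGammaRelator.farCommutativity _ _ hfar)

theorem PachnerType.ofGale_P {n : ℕ} (Y : StandardGaleDiagram 5) (m : Fin 5 ↪ Fin n) (i : Fin 5) :
    (PachnerType.ofGale (k := 4) Y m i).P = {m (i + 3), m (i + 4)} := by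
  change (Y.right i).map m = _
  rw [(Y.left_right_eq i).2, Finset.map_insert, Finset.map_singleton]

theorem PachnerType.ofGale_Q {n : ℕ} (Y : StandardGaleDiagram 5) (m : Fin 5 ↪ Fin n) (i : Fin 5) :
    (PachnerType.ofGale (k := 4) Y m i).Q = {m (i + 1), m (i + 2)} := by
  change (Y.left i).map m = _
  rw [(Y.left_right_eq i).1, Finset.map_insert, Finset.map_singleton]

/-- The relation of the regular pentagon. The pairs `m_t m_{t+1}` are the diagonals of a pentagon
with vertices `m_0, m_2, m_4, m_1, m_3`, and the five flips lead around the cycle of its five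
triangulations. -/
theorem flipGen_pentagon {n : ℕ} (m : Fin 5 → ℕ) (hm : Function.Injective m)
    (hlt : ∀ t, m t < n) :
    flipGen n (m 1) (m 2) (m 3) (m 4) * (flipGen n (m 2) (m 3) (m 4) (m 0) *
      (flipGen n (m 3) (m 4) (m 0) (m 1) * (flipGen n (m 4) (m 0) (m 1) (m 2) *
        flipGen n (m 0) (m 1) (m 2) (m 3)))) = 1 := by
  let m' : Fin 5 ↪ Fin n := ⟨fun t => ⟨m t, hlt t⟩, fun s t h => hm (Fin.mk.inj_iff.1 h)⟩
  have key : ∀ t : Fin 5, flipGen n (m (t + 1)) (m (t + 2)) (m (t + 3)) (m (t + 4)) =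
      PresentedGroup.of (PachnerType.ofGale StandardGaleDiagram.regularPentagon m' t) := by
    intro t
    have h : IsQuad n (m (t + 1)) (m (t + 2)) (m (t + 3)) (m (t + 4)) := by
      refine ⟨⟨hlt _, hlt _, hlt _, hlt _⟩, ?_⟩
      simp only [ne_eq, hm.eq_iff]
      revert t
      decide
    rw [flipGen_of_isQuad h]
    congr 1
    refine PachnerType.ext ?_ ?_
    · rw [PachnerType.ofGale_P]; rfl
    · rw [PachnerType.ofGale_Q]; rfl
  have h0 := key 0
  have h1 := key 1
  have h2 := key 2
  have h3 := key 3
  have h4 := key 4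
  have hrel := PresentedGroup.one_of_mem
    (IsGammaRelator.gon (k := 4) StandardGaleDiagram.regularPentagon m')
  simp only [List.ofFn_succ, List.ofFn_zero, List.prod_cons, List.prod_nil, mul_one, map_mul]
    at hrel
  refine Eq.trans ?_ hrel
  exact congrArg₂ _ h0 (congrArg₂ _ h1 (congrArg₂ _ h2 (congrArg₂ _ h3 h4)))

/-- The two ways of flipping a triangulation of the pentagon `0 < i < j < k < l` to the fan at `0`,
starting from the diagonals `il`, `ik`, agree. The formula holds for `i = 0`, too. -/
theorem flipGen_fan {n i j k l : ℕ} (hij : i < j) (hjk : j < k) (hkl : k < l) (hl : l < n) :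
    flipGen n i l 0 k * flipGen n i k 0 j =
      flipGen n i k j l * (flipGen n i l 0 j * flipGen n j l 0 k) := by
  obtain rfl | hi := Nat.eq_zero_or_pos i
  · rw [flipGen_zero, flipGen_zero, flipGen_zero, one_mul, one_mul, flipGen_mul_flipGen]
  -- the diagonals `li`, `ik`, `k0`, `0j`, `jl` of the pentagon, listed so that neighbours in the
  -- list share an end
  have h := flipGen_pentagon (n := n) ![l, i, k, 0, j] (by
    intro s t
    fin_cases s <;> fin_cases t <;> simp <;> omega) (by
    intro t
    fin_cases t <;> simp <;> omega)
  simp only [Matrix.cons_val] at h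
  rw [flipGen_swap_left n k 0 j l, flipGen_swap_right n 0 j l i, flipGen_swap_left n l i k 0,
    flipGen_swap_right n i l k 0] at h
  have a1 := eq_inv_of_mul_eq_one_left (flipGen_mul_flipGen n 0 k j l)
  have a2 := eq_inv_of_mul_eq_one_left (flipGen_mul_flipGen n 0 j i l)
  have a3 := eq_inv_of_mul_eq_one_left (flipGen_mul_flipGen n j l i k)
  rw [a1, a2, a3] at h
  generalize flipGen n i k 0 j = x, flipGen n i l 0 k = y, flipGen n j l 0 k = u,
    flipGen n i l 0 j = v, flipGen n i k j l = w at *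
  have h2 : x * (u⁻¹ * (v⁻¹ * (w⁻¹ * y))) = x * ((w * (v * u))⁻¹ * y) := by group
  rw [h2] at h
  have h3 : (w * (v * u))⁻¹ * y = x⁻¹ := (inv_eq_of_mul_eq_one_right h).symm
  rw [inv_mul_eq_iff_eq_mul] at h3
  rw [h3]
  group

/-! ### Counting diagonals -/

/-- The number of times that the flip with index `a` creates the diagonal `e`, minus the number of
times it deletes `e`. -/
def PachnerType.weight {n k : ℕ} (e : Finset (Fin n)) (a : PachnerType n k) : ℤ :=
  (if a.P = e then 1 else 0) - (if a.Q = e then 1 else 0)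

/-- Every pentagon relation creates each of the five diagonals once and deletes it once. -/
theorem PachnerType.sum_weight_ofGale {n : ℕ} (e : Finset (Fin n)) (Y : StandardGaleDiagram 5)
    (m : Fin 5 ↪ Fin n) : ∑ i, (PachnerType.ofGale (k := 4) Y m i).weight e = 0 := by
  simp only [PachnerType.weight, PachnerType.ofGale_P, PachnerType.ofGale_Q,
    Finset.sum_sub_distrib]
  rw [sub_eq_zero, ← Equiv.sum_comp (Equiv.addRight (2 : Fin 5))
    (fun i => if ({m (i + 1), m (i + 2)} : Finset (Fin n)) = e then (1 : ℤ) else 0)]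
  refine Finset.sum_congr rfl fun i _ => ?_
  have h1 : i + 3 = i + 2 + 1 := by rw [add_assoc]; rfl
  have h2 : i + 4 = i + 2 + 2 := by rw [add_assoc]; rfl
  rw [Equiv.coe_addRight, h1, h2]

/-- The homomorphism `Γ_n^4 → ℤ` which counts how often the diagonal `e` is created, with signs. -/
def countHom {n : ℕ} (e : Finset (Fin n)) : GammaGroup n 4 →* Multiplicative ℤ :=
  PresentedGroup.toGroup (f := fun a => Multiplicative.ofAdd (a.weight e)) <| by
    rintro _ (a | ⟨a, b, -⟩ | ⟨Y, m⟩)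
    · rw [map_mul, FreeGroup.lift_apply_of, FreeGroup.lift_apply_of, ← ofAdd_add, ofAdd_eq_one]
      change ((if a.Q = e then 1 else 0) - (if a.P = e then 1 else 0) : ℤ) +
        ((if a.P = e then 1 else 0) - (if a.Q = e then 1 else 0)) = 0
      ring
    · rw [map_mul, map_inv, map_mul, map_mul, mul_comm, mul_comm (FreeGroup.lift _ (FreeGroup.of b)),
        inv_mul_cancel]
    · rw [map_list_prod, List.map_ofFn, List.prod_ofFn]
      simp only [Function.comp_apply, FreeGroup.lift_apply_of]
      rw [← ofAdd_sum, PachnerType.sum_weight_ofGale, ofAdd_zero]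

/-- A flip `ac → 0b` deletes `ac` and creates no diagonal `pq` with `p, q > 0`. -/
theorem countHom_flipGen {n p q a b c : ℕ} (hp : 0 < p) (hpq : p < q) (hq : q < n) (hab : a < b)
    (hbc : b < c) (hc : c < n) :
    (countHom {⟨p, hpq.trans hq⟩, ⟨q, hq⟩} (flipGen n a c 0 b)).toAdd =
      if a = p ∧ c = q then -1 else 0 := by
  obtain rfl | ha := Nat.eq_zero_or_pos a
  · rw [flipGen_zero, map_one, toAdd_one, if_neg (by omega)]
  have h : IsQuad n a c 0 b := by unfold IsQuad; omega
  rw [flipGen_of_isQuad h, countHom, PresentedGroup.toGroup.of, toAdd_ofAdd, PachnerType.weight]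
  have h1 : h.pachnerType.P ≠ {⟨p, hpq.trans hq⟩, ⟨q, hq⟩} := by
    intro heq
    have : (⟨0, h.1.2.2.1⟩ : Fin n) ∈ h.pachnerType.P := Finset.mem_insert_self _ _
    simp only [heq, Finset.mem_insert, Finset.mem_singleton, Fin.mk.injEq] at this
    omega
  have h2 : h.pachnerType.Q = {⟨p, hpq.trans hq⟩, ⟨q, hq⟩} ↔ a = p ∧ c = q := by
    constructor
    · intro heq
      have e1 : (⟨a, h.1.1⟩ : Fin n) ∈ h.pachnerType.Q := Finset.mem_insert_self _ _
      have e2 : (⟨c, hc⟩ : Fin n) ∈ h.pachnerType.Q :=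
        Finset.mem_insert_of_mem (Finset.mem_singleton_self _)
      simp only [heq, Finset.mem_insert, Finset.mem_singleton, Fin.mk.injEq] at e1 e2
      omega
    · rintro ⟨rfl, rfl⟩
      rfl
  rw [if_neg h1]
  simp only [h2]
  split_ifs <;> rfl

/-! ### The potential of a triangulation -/

/-- For a chord `ac` of a triangulation, the product of the generators `ac → 0b` attached to the
triangles `a < b < c` on one side of `ac`, every triangle preceding the ones behind its
sides `ab` and `bc`. Performed in this order, these flips turn the triangulation of that side of
`ac`, together with the vertex `0`, into the fan at `0`. Triangles with `a = 0` contribute `1`. -/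
noncomputable def potential {n : ℕ} (D : Finset (Diagonal n)) (a c : ℕ) : GammaGroup n 4 :=
  open Classical in
  if h : ∃ b, a < b ∧ b < c ∧ IsChord D a b ∧ IsChord D b c then
    flipGen n a c 0 h.choose * (potential D a h.choose * potential D h.choose c)
  else 1
termination_by c - a
decreasing_by
  all_goals have := h.choose_spec; omega

theorem potential_of_apex {n : ℕ} (D : Dissection n) {a b c : ℕ} (hab : a < b) (hbc : b < c)
    (h1 : IsChord D.1 a b) (h2 : IsChord D.1 b c) :
    potential D.1 a c = flipGen n a c 0 b * (potential D.1 a b * potential D.1 b c) := by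
  have h : ∃ b, a < b ∧ b < c ∧ IsChord D.1 a b ∧ IsChord D.1 b c := ⟨b, hab, hbc, h1, h2⟩
  -- the apex is unique, since the sides of two triangles on the same base cross
  have hb : h.choose = b := by
    obtain ⟨h3, h4, h5, h6⟩ := h.choose_spec
    have := D.not_interleave h5 h2
    have := D.not_interleave h1 h6
    omega
  rw [potential, dif_pos h, hb]

theorem potential_of_no_apex {n : ℕ} {D : Finset (Diagonal n)} {a c : ℕ}
    (h : ¬∃ b, a < b ∧ b < c ∧ IsChord D a b ∧ IsChord D b c) : potential D a c = 1 := by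
  rw [potential, dif_neg h]

/-- The potential at `ac` depends only on the chords between vertices from `a` to `c`. -/
theorem potential_congr {n : ℕ} (D D' : Dissection n) {a c : ℕ}
    (h : ∀ x y, a ≤ x → y ≤ c → (IsChord D.1 x y ↔ IsChord D'.1 x y)) :
    potential D.1 a c = potential D'.1 a c := by
  induction hm : c - a using Nat.strong_induction_on generalizing a c with
  | _ m ih =>
    by_cases hb : ∃ b, a < b ∧ b < c ∧ IsChord D.1 a b ∧ IsChord D.1 b c
    · obtain ⟨b, hab, hbc, h1, h2⟩ := hb
      rw [potential_of_apex D hab hbc h1 h2, potential_of_apex D' hab hbc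
        ((h a b le_rfl hbc.le).1 h1) ((h b c hab.le le_rfl).1 h2),
        ih (b - a) (by omega) (fun x y hx hy => h x y hx (hy.trans hbc.le)) rfl,
        ih (c - b) (by omega) (fun x y hx hy => h x y (hab.le.trans hx) hy) rfl]
    · rw [potential_of_no_apex hb, potential_of_no_apex]
      rintro ⟨b, hab, hbc, h1, h2⟩
      exact hb ⟨b, hab, hbc, (h a b le_rfl hbc.le).2 h1, (h b c hab.le le_rfl).2 h2⟩

theorem commute_potential {n : ℕ} (D : Dissection n) {g : GammaGroup n 4} {a c : ℕ}
    (h : ∀ x y z, 0 < x → a ≤ x → x < y → y < z → z ≤ c → Commute g (flipGen n x z 0 y)) :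
    Commute g (potential D.1 a c) := by
  induction hm : c - a using Nat.strong_induction_on generalizing a c with
  | _ m ih =>
    by_cases hb : ∃ b, a < b ∧ b < c ∧ IsChord D.1 a b ∧ IsChord D.1 b c
    · obtain ⟨b, hab, hbc, h1, h2⟩ := hb
      rw [potential_of_apex D hab hbc h1 h2]
      refine Commute.mul_right ?_ (Commute.mul_right ?_ ?_)
      · obtain rfl | ha := Nat.eq_zero_or_pos a
        · rw [flipGen_zero]
          exact Commute.one_right _
        · exact h a b c ha le_rfl hab hbc le_rfl
      · exact ih (b - a) (by omega) (fun x y z h0 hx hxy hyz hz =>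
          h x y z h0 hx hxy hyz (hz.trans hbc.le)) rfl
      · exact ih (c - b) (by omega) (fun x y z h0 hx hxy hyz hz =>
          h x y z h0 (hab.le.trans hx) hxy hyz hz) rfl
    · rw [potential_of_no_apex hb]
      exact Commute.one_right _

/-- A flip `ik → jl` changes the potential at the side `il` of the quadrilateral by the generator
of the flip. -/
theorem IsFlip.potential_il {n : ℕ} {S T : Dissection n} {i j k l : ℕ}
    (h : IsFlip S.1 T.1 i j k l) :
    potential S.1 i l = flipGen n i k j l * potential T.1 i l := by
  have hij := h.lt_ij
  have hjk := h.lt_jk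
  have hkl := h.lt_kl
  have hT : ∀ a b, IsChord S.1 a b → ¬(a = i ∧ b = k) → IsChord T.1 a b :=
    fun a b hab hne => ((h.chord_iff a b).1 ⟨hab, hne⟩).1
  have hcongr : ∀ a c, ¬(a ≤ i ∧ k ≤ c) → ¬(a ≤ j ∧ l ≤ c) →
      potential S.1 a c = potential T.1 a c := by
    refine fun a c h1 h2 => potential_congr S T fun x y hx hy => ?_
    have hxy := h.chord_iff x y
    rwa [and_iff_left (by omega), and_iff_left (by omega)] at hxy
  rw [potential_of_apex S (hij.trans hjk) hkl h.diag_ik h.side_kl,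
    potential_of_apex S hij hjk h.side_ij h.side_jk,
    potential_of_apex T hij (hjk.trans hkl) (hT _ _ h.side_ij (by omega)) h.diag_jl,
    potential_of_apex T hjk hkl (hT _ _ h.side_jk (by omega)) (hT _ _ h.side_kl (by omega)),
    hcongr i j (by omega) (by omega), hcongr j k (by omega) (by omega),
    hcongr k l (by omega) (by omega)]
  have hcomm : Commute (flipGen n j l 0 k) (potential T.1 i j) := by
    refine commute_potential T fun x y z h0 hx hxy hyz hz => ?_
    apply flipGen_commute <;> omega
  have hfan := flipGen_fan hij hjk hkl h.side_il.2.1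
  generalize potential T.1 i j = A, potential T.1 j k = B, potential T.1 k l = C at *
  calc flipGen n i l 0 k * (flipGen n i k 0 j * (A * B) * C)
      = flipGen n i l 0 k * flipGen n i k 0 j * (A * (B * C)) := by simp only [mul_assoc]
    _ = flipGen n i k j l * (flipGen n i l 0 j * (flipGen n j l 0 k * A * (B * C))) := by
      rw [hfan]; simp only [mul_assoc]
    _ = _ := by rw [hcomm.eq]; simp only [mul_assoc]

/-- A flip changes the potential at every chord enclosing the quadrilateral by the generator of the
flip, which commutes with the generators of the triangles outside the quadrilateral. -/
theorem IsFlip.potential_eq {n : ℕ} {S T : Dissection n} (hS : IsMax S) {i j k l : ℕ}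
    (h : IsFlip S.1 T.1 i j k l) {a c : ℕ} (hac : IsChord S.1 a c) (hai : a ≤ i) (hlc : l ≤ c) :
    potential S.1 a c = flipGen n i k j l * potential T.1 a c := by
  have hij := h.lt_ij
  have hjk := h.lt_jk
  have hkl := h.lt_kl
  induction hm : c - a using Nat.strong_induction_on generalizing a c with
  | _ m ih =>
    by_cases hne : a = i ∧ c = l
    · rw [hne.1, hne.2]
      exact h.potential_il
    obtain ⟨b, hab, hbc, h1, h2⟩ := Dissection.exists_apex hS hac (by omega)
    -- the side `il` crosses neither `ab` nor `bc`, so it lies behind one of them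
    have hout : b ≤ i ∨ l ≤ b := by
      have := S.not_interleave h1 h.side_il
      have := S.not_interleave h.side_il h2
      omega
    have hT : ∀ x y, IsChord S.1 x y → ¬(x = i ∧ y = k) → IsChord T.1 x y :=
      fun x y hxy hne => ((h.chord_iff x y).1 ⟨hxy, hne⟩).1
    have hcongr : ∀ x y, ¬(x ≤ i ∧ k ≤ y) → ¬(x ≤ j ∧ l ≤ y) →
        potential S.1 x y = potential T.1 x y := by
      refine fun x y hx hy => potential_congr S T fun z w hz hw => ?_
      have hzw := h.chord_iff z w
      rwa [and_iff_left (by omega), and_iff_left (by omega)] at hzw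
    have hcomm : Commute (flipGen n a c 0 b) (flipGen n i k j l) := by
      obtain rfl | ha := Nat.eq_zero_or_pos a
      · rw [flipGen_zero]
        exact Commute.one_left _
      · rcases hout with hout | hout <;> apply flipGen_commute <;> omega
    rw [potential_of_apex S hab hbc h1 h2, potential_of_apex T hab hbc
      (hT _ _ h1 (by omega)) (hT _ _ h2 (by omega))]
    rcases hout with hout | hout
    · rw [ih (c - b) (by omega) h2 hout hlc rfl, hcongr a b (by omega) (by omega)]
      have hcomm' : Commute (flipGen n i k j l) (potential T.1 a b) := by
        refine commute_potential T fun x y z h0 hx hxy hyz hz => ?_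
        apply flipGen_commute <;> omega
      rw [← mul_assoc (potential T.1 a b), ← hcomm'.eq, mul_assoc, ← mul_assoc, hcomm.eq, mul_assoc]
    · rw [ih (b - a) (by omega) h1 hai hout rfl, hcongr b c (by omega) (by omega)]
      rw [mul_assoc, ← mul_assoc, hcomm.eq, mul_assoc]

/-- The potential at `ac` of a triangulation detects the diagonals `pq`, `p > 0`, behind `ac`. -/
theorem countHom_potential {n : ℕ} {D : Dissection n} (hD : IsMax D) {p q : ℕ} (hp : 0 < p)
    (hpq : p + 1 < q) (hq : q < n) {a c : ℕ} (hac : IsChord D.1 a c) :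
    (countHom {⟨p, by omega⟩, ⟨q, hq⟩} (potential D.1 a c)).toAdd =
      open Classical in if a ≤ p ∧ q ≤ c ∧ IsChord D.1 p q then -1 else 0 := by
  induction hm : c - a using Nat.strong_induction_on generalizing a c with
  | _ m ih =>
    by_cases hc : a + 1 < c
    · obtain ⟨b, hab, hbc, h1, h2⟩ := Dissection.exists_apex hD hac hc
      rw [potential_of_apex D hab hbc h1 h2, map_mul (countHom _), map_mul (countHom _), toAdd_mul,
        toAdd_mul,
        countHom_flipGen hp (by omega) hq hab hbc hac.2.1,
        ih (b - a) (by omega) h1 rfl, ih (c - b) (by omega) h2 rfl]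
      by_cases hE : IsChord D.1 p q
      · have := D.not_interleave h1 hE
        have := D.not_interleave hE h2
        simp only [hE, and_true]
        split_ifs <;> omega
      · have : ¬(a = p ∧ c = q) := by
          rintro ⟨rfl, rfl⟩
          exact hE hac
        simp [hE, this]
    · rw [potential_of_no_apex (by rintro ⟨b, hb⟩; omega), map_one, toAdd_one, if_neg]
      omega

/-- The potential determines the triangulation: it determines the diagonals which avoid the vertex
`0`, and the others are then the diagonals at `0` which cross none of these. -/
theorem le_of_potential_eq {n : ℕ} (hn : 4 ≤ n) {S T : Dissection n} (hS : IsMax S) (hT : IsMax T)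
    (h : potential S.1 0 (n - 1) = potential T.1 0 (n - 1)) : S ≤ T := by
  have h0 : ∀ D : Dissection n, IsChord D.1 0 (n - 1) := fun D =>
    ⟨by omega, by omega, Or.inr (Or.inl ⟨rfl, by omega⟩)⟩
  have hiff : ∀ d : Diagonal n, 0 < d.fst.val → (d ∈ S.1 ↔ d ∈ T.1) := by
    intro d hd
    have h1 := countHom_potential hS hd d.fst_succ_lt_snd d.snd.isLt (h0 S)
    rw [h, countHom_potential hT hd d.fst_succ_lt_snd d.snd.isLt (h0 T)] at h1
    have hle : d.snd.val ≤ n - 1 := by have := d.snd.isLt; omega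
    rw [Diagonal.mem_iff_isChord, Diagonal.mem_iff_isChord]
    have hz := Nat.zero_le d.fst.val
    split_ifs at h1 with hT' hS' hS'
    · exact iff_of_true hS'.2.2 hT'.2.2
    · exact iff_of_false (fun hc => hS' ⟨hz, hle, hc⟩) fun hc => hT' ⟨hz, hle, hc⟩
  intro d hd
  obtain hd0 | hd0 := Nat.eq_zero_or_pos d.fst.val
  · refine Dissection.mem_of_isMax hT fun e he hde => ?_
    have he0 : 0 < e.fst.val := by
      rw [Diagonal.crosses_iff] at hde
      omega
    exact S.2 d hd e ((hiff e he0).2 he) hde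
  · exact (hiff d hd0).1 hd

/-! ### The embedding of the flip graph -/

/-- Inverting the potential turns the multiplication on the left by the generator of a flip into
the multiplication on the right that defines the Cayley graph. -/
theorem gammaCayleyGraph_adj_of_isFlip {n : ℕ} (hn : 4 ≤ n) {S T : Dissection n} (hS : IsMax S)
    (hne : (potential S.1 0 (n - 1))⁻¹ ≠ (potential T.1 0 (n - 1))⁻¹) {i j k l : ℕ}
    (h : IsFlip S.1 T.1 i j k l) :
    (gammaCayleyGraph n 4).Adj (potential S.1 0 (n - 1))⁻¹ (potential T.1 0 (n - 1))⁻¹ := by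
  have hij := h.lt_ij
  have hjk := h.lt_jk
  have hkl := h.lt_kl
  have hl := h.side_kl.2.1
  have hq : IsQuad n i k j l := by unfold IsQuad; omega
  refine (SimpleGraph.mulCayley_adj' _ _ _).2
    ⟨hne, _, ⟨hq.pachnerType, rfl⟩, Or.inl ?_⟩
  rw [← flipGen_of_isQuad hq, h.potential_eq hS
    ⟨by omega, by omega, Or.inr (Or.inl ⟨rfl, by omega⟩)⟩ (Nat.zero_le _) (by omega)]
  group

theorem flipGraph_isContained (n : ℕ) (hn : 4 ≤ n) :
    SimpleGraph.IsContained (flipGraph n) (gammaCayleyGraph n 4) := by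
  have hinj : Function.Injective
      fun T : PolygonTriangulation n => (potential T.1.1 0 (n - 1))⁻¹ := fun S T h =>
    Subtype.ext (le_antisymm (le_of_potential_eq hn S.2 T.2 (inv_injective h))
      (le_of_potential_eq hn T.2 S.2 (inv_injective h).symm))
  refine ⟨⟨⟨fun T => (potential T.1.1 0 (n - 1))⁻¹, ?_⟩, hinj⟩⟩
  intro S T hST
  have hne := hinj.ne hST.ne
  obtain ⟨i, j, k, l, h | h⟩ := exists_isFlip_of_adj hST
  · exact gammaCayleyGraph_adj_of_isFlip hn S.2 hne h
  · exact (gammaCayleyGraph_adj_of_isFlip hn T.2 hne.symm h).symm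

theorem mainTheorem6 (n : ℕ) (hn : 4 ≤ n) :
    Nonempty (faceEdgeGraph (AssociahedronFace n) ≃g flipGraph n) ∧
      SimpleGraph.IsContained (faceEdgeGraph (AssociahedronFace n)) (gammaCayleyGraph n 4) ∧
      ∀ (d : ℕ) (K : Set (EuclideanSpace ℝ (Fin d))), IsAssociahedron n K →
        Nonempty (polytopeEdgeGraph K ≃g flipGraph n) ∧
          SimpleGraph.IsContained (polytopeEdgeGraph K) (gammaCayleyGraph n 4) := by
  have hflip := flipGraph_isContained n hn
  refine ⟨⟨faceEdgeGraphIsoFlipGraph n⟩,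
    (faceEdgeGraphIsoFlipGraph n).isContained.trans hflip, fun d K hK => ?_⟩
  obtain ⟨hpoly, ⟨φ⟩⟩ := hK
  have e : polytopeEdgeGraph K ≃g flipGraph n :=
    ((polytopeEdgeGraphIso hpoly).trans (faceEdgeGraphCongr φ)).trans (faceEdgeGraphIsoFlipGraph n)
  exact ⟨⟨e⟩, e.isContained.trans hflip⟩
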